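/- For a positive integer $n$ let $A_n$ be the universal unital C*-algebra generated by elements $a_{ij}$, $1\le i,j\le n$, with the relations $a_{ij}^*=a_{ij}=a_{ij}^2$ and $\sum_{i}a_{ij}=\sum_{j}a_{ij}=1$, and let $\Delta_n:A_n\to A_n\otimes A_n$ be the unital $*$-homomorphism with $\Delta_n(a_{ij})=\sum_k a_{ik}\otimes a_{kj}$; here $\otimes$ is the minimal C*-tensor product. A compact quantum group is a unital C*-algebra $A$ with a unital $*$-homomorphism $\Delta:A\to A\otimes A$ such that $(\Delta\otimes\mathrm{id})\Delta=(\mathrm{id}\otimes\Delta)\Delta$ and the linear spans $\Delta(A)(1\otimes A)$ and $\Delta(A)(A\otimes 1)$ are dense in $A\otimes A$. An action of $(A,\Delta)$ on a unital C*-algebra $B$ is a unital $*$-homomorphism $\alpha:B\to B\otimes A$ such that $(\alpha\otimes\mathrm{id})\alpha=(\mathrm{id}\otimes\Delta)\alpha$ and the linear span $\alpha(B)(1\otimes A)$ is dense in $B\otimes A$; an action on a compact Hausdorff space $X$ is an action on $C(X)$. A unital C*-subalgebra $Q\subseteq A$ is a compact quantum quotient group of $(A,\Delta)$ if $\Delta(Q)\subseteq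 Q\otimes Q$ and $(Q,\Delta|_Q)$ is a compact quantum group. The action $\alpha$ is faithful if there is no compact quantum quotient group $Q\ne A$ of $(A,\Delta)$ such that $\alpha(B)\subseteq B\otimes Q$ and $\alpha$, viewed as a map $B\to B\otimes Q$, is an action of $Q$ on $B$. Theorem. Let $n\ge1$, let $X_n=\{x_1,\dots,x_n\}$ be the discrete space with $n$ points, with $e_i\in C(X_n)$ the indicator function of $x_i$, let $Y$ be a compact Hausdorff space and let $Y_1\subseteq Y$ be a closed subset with $Y_1\ne Y$. Let $\sim$ be the equivalence relation on $X_n\times Y$ for which $(x',y')\sim(x'',y'')$ if and only if $y'=y''\in Y_1$, or $y'=y''$ and $x'=x''$. Let $\alpha:C(X_n\times Y)\to C(X_n\times Y)\otimes A_n$ be the unital $*$-homomorphism with $\alpha(e_i\otimes f)=\sum_{k}e_k\otimes f\otimes a_{ki}$ for $1\le i\le n$ and $f\in C(Y)$. Then: 1. $(A_n,\Delta_n)$ is a compact quantum group, and $(X_n\times Y)/{\sim}$ is a compact Hausdorff space. 2. The restriction of $\alpha$ to $C((X_n\times Y)/{\sim})\subseteq C(X_n\times Y)$ takes values in $C((X_n\times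 Y)/{\sim})\otimes A_n$ and is an action $\widetilde\alpha$ of $A_n$ on $(X_n\times Y)/{\sim}$. This action is faithful. 3. If $Y$ is connected and $Y_1\neq\emptyset$, then $(X_n\times Y)/{\sim}$ is connected. 4. If $n\ge4$, then $A_n$ is not commutative. In particular, if $n\ge 4$, $Y$ is connected and $Y_1\neq\emptyset$, then $\widetilde\alpha$ is a faithful action of a genuine (that is, non-commutative) compact quantum group on a connected compact Hausdorff space, contrary to Goswami's conjecture. -/

import Mathlib

open scoped TensorProduct

universe u

noncomputable section

/-! ### Completion of a complex `*`-algebra for a C*-seminorm -/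

/-- A C*-seminorm on a unital complex `*`-algebra. -/
structure CStarSeminorm (E : Type u) [Ring E] [StarRing E] [Algebra ℂ E] [StarModule ℂ E] where
  toFun : E → ℝ
  nonneg : ∀ x, 0 ≤ toFun x
  add_le : ∀ x y, toFun (x + y) ≤ toFun x + toFun y
  smul_eq : ∀ (c : ℂ) (x : E), toFun (c • x) = ‖c‖ * toFun x
  mul_le : ∀ x y, toFun (x * y) ≤ toFun x * toFun y
  star_mul_self : ∀ x, toFun (star x * x) = toFun x * toFun x

namespace CStarSeminorm

variable {E : Type u} [Ring E] [StarRing E] [Algebra ℂ E] [StarModule ℂ E]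

theorem map_zero (p : CStarSeminorm E) : p.toFun 0 = 0 := by
  simpa using p.smul_eq 0 0

theorem map_neg (p : CStarSeminorm E) (x : E) : p.toFun (-x) = p.toFun x := by
  simpa using p.smul_eq (-1) x

theorem le_map_star (p : CStarSeminorm E) (x : E) : p.toFun x ≤ p.toFun (star x) := by
  have h1 := p.mul_le (star x) x
  rw [p.star_mul_self] at h1
  rcases (p.nonneg x).eq_or_lt with h | h
  · rw [← h]; exact p.nonneg _
  · exact le_of_mul_le_mul_right h1 h

theorem map_star (p : CStarSeminorm E) (x : E) : p.toFun (star x) = p.toFun x :=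
  le_antisymm (by simpa using p.le_map_star (star x)) (p.le_map_star x)

/-- The `*`-algebra `E`, equipped with the seminorm `p`. -/
def Pre (_ : CStarSeminorm E) : Type u := E

variable (p : CStarSeminorm E)

instance : Ring p.Pre := inferInstanceAs (Ring E)
instance : StarRing p.Pre := inferInstanceAs (StarRing E)
instance : Algebra ℂ p.Pre := inferInstanceAs (Algebra ℂ E)
instance : StarModule ℂ p.Pre := inferInstanceAs (StarModule ℂ E)

instance : SeminormedAddCommGroup p.Pre :=
  AddGroupSeminorm.toSeminormedAddCommGroup
    { toFun := p.toFun
      map_zero' := p.map_zero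
      add_le' := p.add_le
      neg' := p.map_neg }

theorem norm_pre (x : p.Pre) : ‖x‖ = p.toFun x := rfl

instance : SeminormedRing p.Pre where
  __ : SeminormedAddCommGroup p.Pre := inferInstance
  __ : Ring p.Pre := inferInstance
  norm_mul_le := p.mul_le

instance : NormedAlgebra ℂ p.Pre where
  norm_smul_le c x := (p.smul_eq c x).le

instance : NormedStarGroup p.Pre where
  norm_star_le x := (p.map_star x).le

/-- The Hausdorff completion of `E` for the seminorm `p`: elements of seminorm zero are divided
out, and the result is completed. -/
def Completion : Type u := UniformSpace.Completion p.Pre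

instance : NormedRing p.Completion := inferInstanceAs (NormedRing (UniformSpace.Completion p.Pre))
instance : Algebra ℂ p.Completion :=
  inferInstanceAs (Algebra ℂ (UniformSpace.Completion p.Pre))
instance : CompleteSpace p.Completion :=
  inferInstanceAs (CompleteSpace (UniformSpace.Completion p.Pre))

/-- The canonical map of `E` to its completion. -/
def coe (x : E) : p.Completion := ((show p.Pre from x : p.Pre) : UniformSpace.Completion p.Pre)

theorem norm_coe (x : E) : ‖p.coe x‖ = p.toFun x :=
  UniformSpace.Completion.norm_coe (E := p.Pre) x

theorem denseRange_coe : DenseRange p.coe :=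
  UniformSpace.Completion.denseRange_coe (α := p.Pre)

theorem coe_add (x y : E) : p.coe (x + y) = p.coe x + p.coe y :=
  UniformSpace.Completion.coe_add (α := p.Pre) x y

theorem coe_mul (x y : E) : p.coe (x * y) = p.coe x * p.coe y :=
  UniformSpace.Completion.coe_mul (α := p.Pre) x y

theorem coe_smul (c : ℂ) (x : E) : p.coe (c • x) = c • p.coe x :=
  UniformSpace.Completion.coe_smul (X := p.Pre) c x

instance : NormedAlgebra ℂ p.Completion where
  norm_smul_le c x :=
    (norm_smul_le c (show UniformSpace.Completion p.Pre from x))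

instance : Star p.Completion :=
  ⟨UniformSpace.Completion.map (star : p.Pre → p.Pre)⟩

theorem isometry_star_pre : Isometry (star : p.Pre → p.Pre) := star_isometry

theorem coe_star (x : E) : p.coe (star x) = star (p.coe x) :=
  (UniformSpace.Completion.map_coe p.isometry_star_pre.uniformContinuous (show p.Pre from x)).symm

theorem continuous_star' : Continuous (star : p.Completion → p.Completion) :=
  UniformSpace.Completion.continuous_map

instance : StarRing p.Completion where
  star_involutive x := by
    refine p.denseRange_coe.induction_on x
      (isClosed_eq (p.continuous_star'.comp p.continuous_star') continuous_id) fun a => ?_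
    rw [← coe_star, ← coe_star, star_star]
  star_mul x y := by
    refine p.denseRange_coe.induction_on₂ (isClosed_eq (p.continuous_star'.comp continuous_mul)
      ((p.continuous_star'.comp continuous_snd).mul (p.continuous_star'.comp continuous_fst)))
      (fun a b => ?_) x y
    rw [← coe_mul, ← coe_star, ← coe_star, ← coe_star, ← coe_mul, star_mul]
  star_add x y := by
    refine p.denseRange_coe.induction_on₂ (isClosed_eq (p.continuous_star'.comp continuous_add)
      ((p.continuous_star'.comp continuous_fst).add (p.continuous_star'.comp continuous_snd)))
      (fun a b => ?_) x y
    rw [← coe_add, ← coe_star, ← coe_star, ← coe_star, ← coe_add, star_add]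

instance : StarModule ℂ p.Completion where
  star_smul c x := by
    refine p.denseRange_coe.induction_on x (isClosed_eq
      (p.continuous_star'.comp (continuous_const_smul c))
      (p.continuous_star'.const_smul (star c))) fun a => ?_
    rw [← coe_smul, ← coe_star, ← coe_star, ← coe_smul, star_smul]

instance : CStarRing p.Completion where
  norm_mul_self_le x := by
    refine p.denseRange_coe.induction_on x (isClosed_le (by fun_prop)
      (continuous_norm.comp (p.continuous_star'.mul continuous_id))) fun a => ?_
    rw [← coe_star, ← coe_mul, norm_coe, norm_coe, p.star_mul_self]

instance : CStarAlgebra p.Completion where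

/-- The canonical `*`-homomorphism of `E` to its completion. -/
def ofHom : E →⋆ₐ[ℂ] p.Completion where
  toFun := p.coe
  map_one' := UniformSpace.Completion.coe_one p.Pre
  map_mul' := p.coe_mul
  map_zero' := UniformSpace.Completion.coe_zero
  map_add' := p.coe_add
  commutes' c := by
    rw [Algebra.algebraMap_eq_smul_one, Algebra.algebraMap_eq_smul_one, coe_smul]
    rfl
  map_star' := p.coe_star

theorem ofHom_apply (x : E) : p.ofHom x = p.coe x := rfl

theorem norm_ofHom (x : E) : ‖p.ofHom x‖ = p.toFun x := p.norm_coe x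

theorem denseRange_ofHom : DenseRange p.ofHom := p.denseRange_coe

section Lift

variable {D : Type u} [CStarAlgebra D]

/-- The extension by continuity of `φ` to the completion, as a plain function. -/
def liftFun (φ : E →⋆ₐ[ℂ] D) : p.Completion → D :=
  UniformSpace.Completion.extension (α := p.Pre) (fun x => φ x)


theorem uniformContinuous_pre (φ : E →⋆ₐ[ℂ] D) (h : ∀ x, ‖φ x‖ ≤ p.toFun x) :
    UniformContinuous (fun x : p.Pre => φ x) := by
  have : LipschitzWith 1 (fun x : p.Pre => φ x) := by
    refine LipschitzWith.of_dist_le_mul fun x y => ?_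
    rw [dist_eq_norm, dist_eq_norm, NNReal.coe_one, one_mul, p.norm_pre]
    have := h ((show E from x) - (show E from y))
    rw [map_sub] at this
    exact this
  exact this.uniformContinuous

theorem continuous_liftFun (φ : E →⋆ₐ[ℂ] D) : Continuous (p.liftFun φ) :=
  UniformSpace.Completion.continuous_extension

theorem liftFun_coe (φ : E →⋆ₐ[ℂ] D) (h : ∀ x, ‖φ x‖ ≤ p.toFun x) (x : E) :
    p.liftFun φ (p.coe x) = φ x :=
  UniformSpace.Completion.extension_coe (p.uniformContinuous_pre φ h) (show p.Pre from x)

/-- A `*`-homomorphism of `E` to a C*-algebra that is dominated by `p` extends to the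
completion. -/
def lift (φ : E →⋆ₐ[ℂ] D) (h : ∀ x, ‖φ x‖ ≤ p.toFun x) : p.Completion →⋆ₐ[ℂ] D where
  toFun := p.liftFun φ
  map_one' := by
    have := p.liftFun_coe φ h 1
    rwa [map_one, ← p.ofHom_apply, map_one] at this
  map_mul' x y := by
    have hc := p.continuous_liftFun φ
    refine p.denseRange_coe.induction_on₂ (isClosed_eq (hc.comp continuous_mul)
      ((hc.comp continuous_fst).mul (hc.comp continuous_snd))) (fun a b => ?_) x y
    rw [← coe_mul, p.liftFun_coe φ h, p.liftFun_coe φ h, p.liftFun_coe φ h, _root_.map_mul]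
  map_zero' := by
    have := p.liftFun_coe φ h 0
    rwa [_root_.map_zero, ← p.ofHom_apply, _root_.map_zero] at this
  map_add' x y := by
    have hc := p.continuous_liftFun φ
    refine p.denseRange_coe.induction_on₂ (isClosed_eq (hc.comp continuous_add)
      ((hc.comp continuous_fst).add (hc.comp continuous_snd))) (fun a b => ?_) x y
    rw [← coe_add, p.liftFun_coe φ h, p.liftFun_coe φ h, p.liftFun_coe φ h, _root_.map_add]
  commutes' c := by
    have := p.liftFun_coe φ h (algebraMap ℂ E c)
    rwa [← p.ofHom_apply, AlgHomClass.commutes, AlgHomClass.commutes] at this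
  map_star' x := by
    have hc := p.continuous_liftFun φ
    refine p.denseRange_coe.induction_on x (isClosed_eq (hc.comp p.continuous_star')
      (continuous_star.comp hc)) fun a => ?_
    rw [← coe_star, p.liftFun_coe φ h, p.liftFun_coe φ h, StarHomClass.map_star φ]

theorem lift_ofHom (φ : E →⋆ₐ[ℂ] D) (h : ∀ x, ‖φ x‖ ≤ p.toFun x) (x : E) :
    p.lift φ h (p.ofHom x) = φ x :=
  p.liftFun_coe φ h x

theorem continuous_lift (φ : E →⋆ₐ[ℂ] D) (h : ∀ x, ‖φ x‖ ≤ p.toFun x) :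
    Continuous (p.lift φ h) :=
  p.continuous_liftFun φ

end Lift

end CStarSeminorm

/-! ### The minimal tensor product of C*-algebras -/

section SpatialNorm

variable {A B : Type u} [CStarAlgebra A] [CStarAlgebra B]
  {H K : Type u} [NormedAddCommGroup H] [InnerProductSpace ℂ H] [CompleteSpace H]
  [NormedAddCommGroup K] [InnerProductSpace ℂ K] [CompleteSpace K]

/-- For representations `π` of `A` on `H` and `ρ` of `B` on `K`, the representation `π ⊗ ρ` of the
algebraic tensor product `A ⊗ B` by bounded operators on the algebraic tensor product `H ⊗ K`, with
`(π ⊗ ρ) (a ⊗ b) = π a ⊗ ρ b`. The space `H ⊗ K` carries the inner product with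
`⟪h ⊗ k, h' ⊗ k'⟫ = ⟪h, h'⟫ ⟪k, k'⟫`, and the operator norm on this dense subspace of the Hilbert
space tensor product is the operator norm on the Hilbert space tensor product. -/
def tensorRep (π : A →⋆ₐ[ℂ] (H →L[ℂ] H)) (ρ : B →⋆ₐ[ℂ] (K →L[ℂ] K)) :
    (A ⊗[ℂ] B) →ₐ[ℂ] ((H ⊗[ℂ] K) →L[ℂ] (H ⊗[ℂ] K)) :=
  Algebra.TensorProduct.algHomOfLinearMapTensorProduct
    (TensorProduct.lift
      (LinearMap.mk₂ ℂ (fun a b => TensorProduct.mapL (π a) (ρ b))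
        (fun a a' b => by rw [map_add, TensorProduct.mapL_add_left])
        (fun c a b => by rw [map_smul, TensorProduct.mapL_smul_left])
        (fun a b b' => by rw [map_add, TensorProduct.mapL_add_right])
        (fun c a b => by rw [map_smul, TensorProduct.mapL_smul_right])))
    (fun a a' b b' => by
      simp only [TensorProduct.lift.tmul, LinearMap.mk₂_apply, map_mul]
      exact TensorProduct.mapL_mul _ _ _ _)
    (by
      simp only [TensorProduct.lift.tmul, LinearMap.mk₂_apply, map_one]
      exact TensorProduct.mapL_id_id)

theorem tensorRep_tmul (π : A →⋆ₐ[ℂ] (H →L[ℂ] H)) (ρ : B →⋆ₐ[ℂ] (K →L[ℂ] K)) (a : A) (b : B) :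
    tensorRep π ρ (a ⊗ₜ b) = TensorProduct.mapL (π a) (ρ b) := rfl

theorem inner_tensorRep_star (π : A →⋆ₐ[ℂ] (H →L[ℂ] H)) (ρ : B →⋆ₐ[ℂ] (K →L[ℂ] K))
    (x : A ⊗[ℂ] B) (ξ η : H ⊗[ℂ] K) :
    inner ℂ (tensorRep π ρ (star x) ξ) η = inner ℂ ξ (tensorRep π ρ x η) := by
  induction x using TensorProduct.induction_on with
  | zero => simp
  | add x y hx hy => simp [inner_add_left, inner_add_right, hx, hy]
  | tmul a b =>
    rw [TensorProduct.star_tmul, tensorRep_tmul, tensorRep_tmul]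
    induction ξ using TensorProduct.induction_on with
    | zero => simp
    | add x y hx hy => simp only [map_add, inner_add_left, hx, hy]
    | tmul h k =>
      induction η using TensorProduct.induction_on with
      | zero => simp
      | add x y hx hy => simp only [map_add, inner_add_right, hx, hy]
      | tmul h' k' =>
        rw [TensorProduct.mapL_tmul, TensorProduct.mapL_tmul, TensorProduct.inner_tmul,
          TensorProduct.inner_tmul, map_star, map_star, ContinuousLinearMap.star_eq_adjoint,
          ContinuousLinearMap.star_eq_adjoint, ContinuousLinearMap.adjoint_inner_left,
          ContinuousLinearMap.adjoint_inner_left]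

theorem norm_tensorRep_star_mul_self (π : A →⋆ₐ[ℂ] (H →L[ℂ] H)) (ρ : B →⋆ₐ[ℂ] (K →L[ℂ] K))
    (x : A ⊗[ℂ] B) :
    ‖tensorRep π ρ x‖ * ‖tensorRep π ρ x‖ ≤ ‖tensorRep π ρ (star x * x)‖ := by
  have key : ‖tensorRep π ρ x‖ ≤ √‖tensorRep π ρ (star x * x)‖ := by
    refine ContinuousLinearMap.opNorm_le_bound _ (Real.sqrt_nonneg _) fun ξ => ?_
    refine le_of_sq_le_sq ?_ (by positivity)
    rw [mul_pow, Real.sq_sqrt (ContinuousLinearMap.opNorm_nonneg _)]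
    have h1 : ‖tensorRep π ρ x ξ‖ ^ 2
        = RCLike.re (inner ℂ (tensorRep π ρ (star x * x) ξ) ξ) := by
      rw [map_mul, mul_apply_eq_comp, inner_tensorRep_star,
        ← inner_self_eq_norm_sq (𝕜 := ℂ)]
    rw [h1]
    calc RCLike.re (inner ℂ (tensorRep π ρ (star x * x) ξ) ξ)
        ≤ ‖tensorRep π ρ (star x * x) ξ‖ * ‖ξ‖ :=
          re_inner_le_norm (𝕜 := ℂ) (E := H ⊗[ℂ] K) _ _
      _ ≤ ‖tensorRep π ρ (star x * x)‖ * ‖ξ‖ * ‖ξ‖ := by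
          gcongr; exact ContinuousLinearMap.le_opNorm _ _
      _ = _ := by ring
  calc _ ≤ √‖tensorRep π ρ (star x * x)‖ * √‖tensorRep π ρ (star x * x)‖ := by gcongr
    _ = _ := Real.mul_self_sqrt (ContinuousLinearMap.opNorm_nonneg _)

theorem norm_starAlgHom_le (π : A →⋆ₐ[ℂ] (H →L[ℂ] H)) (a : A) : ‖π a‖ ≤ ‖a‖ :=
  NonUnitalStarAlgHom.norm_apply_le π a

theorem exists_bound_tensorRep (x : A ⊗[ℂ] B) :
    ∃ C : ℝ, ∀ (H K : Type u) [NormedAddCommGroup H] [InnerProductSpace ℂ H] [CompleteSpace H]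
      [NormedAddCommGroup K] [InnerProductSpace ℂ K] [CompleteSpace K]
      (π : A →⋆ₐ[ℂ] (H →L[ℂ] H)) (ρ : B →⋆ₐ[ℂ] (K →L[ℂ] K)), ‖tensorRep π ρ x‖ ≤ C := by
  induction x using TensorProduct.induction_on with
  | zero => exact ⟨0, by intros; rw [map_zero]; exact ContinuousLinearMap.opNorm_zero.le⟩
  | add x y hx hy =>
    obtain ⟨C, hC⟩ := hx
    obtain ⟨C', hC'⟩ := hy
    refine ⟨C + C', ?_⟩
    intro H K _ _ _ _ _ _ π ρ
    rw [map_add]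
    exact (ContinuousLinearMap.opNorm_add_le _ _).trans (add_le_add (hC H K π ρ) (hC' H K π ρ))
  | tmul a b =>
    refine ⟨‖a‖ * ‖b‖, ?_⟩
    intro H K _ _ _ _ _ _ π ρ
    rw [tensorRep_tmul]
    refine (TensorProduct.norm_mapL_le _ _).trans ?_
    gcongr
    · exact norm_starAlgHom_le π a
    · exact norm_starAlgHom_le ρ b

variable (A B) in
/-- The values `‖(π ⊗ ρ) x‖` for representations `π` of `A` and `ρ` of `B` on Hilbert spaces. -/
def spatialNormSet (x : A ⊗[ℂ] B) : Set ℝ :=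
  {r | ∃ (H K : Type u) (_ : NormedAddCommGroup H) (_ : InnerProductSpace ℂ H)
    (_ : CompleteSpace H) (_ : NormedAddCommGroup K) (_ : InnerProductSpace ℂ K)
    (_ : CompleteSpace K) (π : A →⋆ₐ[ℂ] (H →L[ℂ] H)) (ρ : B →⋆ₐ[ℂ] (K →L[ℂ] K)),
    r = ‖tensorRep π ρ x‖}

/-- The minimal (spatial) C*-norm on the algebraic tensor product of two C*-algebras: the supremum
of `‖(π ⊗ ρ) x‖` over all representations `π` of `A` and `ρ` of `B` on Hilbert spaces. -/
def spatialNorm (x : A ⊗[ℂ] B) : ℝ := sSup (spatialNormSet A B x)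

theorem bddAbove_spatialNormSet (x : A ⊗[ℂ] B) : BddAbove (spatialNormSet A B x) := by
  obtain ⟨C, hC⟩ := exists_bound_tensorRep x
  refine ⟨C, ?_⟩
  rintro r ⟨H, K, _, _, _, _, _, _, π, ρ, rfl⟩
  exact hC H K π ρ

theorem norm_tensorRep_le (π : A →⋆ₐ[ℂ] (H →L[ℂ] H)) (ρ : B →⋆ₐ[ℂ] (K →L[ℂ] K))
    (x : A ⊗[ℂ] B) : ‖tensorRep π ρ x‖ ≤ spatialNorm x :=
  le_csSup (bddAbove_spatialNormSet x) ⟨H, K, _, _, ‹_›, _, _, ‹_›, π, ρ, rfl⟩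

theorem spatialNorm_nonneg (x : A ⊗[ℂ] B) : 0 ≤ spatialNorm x := by
  refine Real.sSup_nonneg ?_
  rintro r ⟨H, K, _, _, _, _, _, _, π, ρ, rfl⟩
  exact ContinuousLinearMap.opNorm_nonneg _

theorem spatialNorm_le {x : A ⊗[ℂ] B} {C : ℝ} (hC : 0 ≤ C)
    (h : ∀ (H K : Type u) [NormedAddCommGroup H] [InnerProductSpace ℂ H] [CompleteSpace H]
      [NormedAddCommGroup K] [InnerProductSpace ℂ K] [CompleteSpace K]
      (π : A →⋆ₐ[ℂ] (H →L[ℂ] H)) (ρ : B →⋆ₐ[ℂ] (K →L[ℂ] K)), ‖tensorRep π ρ x‖ ≤ C) :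
    spatialNorm x ≤ C := by
  refine Real.sSup_le ?_ hC
  rintro r ⟨H, K, _, _, _, _, _, _, π, ρ, rfl⟩
  exact h H K π ρ

theorem spatialNorm_smul_le (c : ℂ) (x : A ⊗[ℂ] B) :
    spatialNorm (c • x) ≤ ‖c‖ * spatialNorm x := by
  refine spatialNorm_le (mul_nonneg (norm_nonneg _) (spatialNorm_nonneg _)) ?_
  intro H K _ _ _ _ _ _ π ρ
  rw [map_smul]
  exact (ContinuousLinearMap.opNorm_smul_le _ _).trans
    (mul_le_mul_of_nonneg_left (norm_tensorRep_le π ρ x) (norm_nonneg _))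

theorem spatialNorm_mul_le (x y : A ⊗[ℂ] B) :
    spatialNorm (x * y) ≤ spatialNorm x * spatialNorm y := by
  refine spatialNorm_le (mul_nonneg (spatialNorm_nonneg _) (spatialNorm_nonneg _)) ?_
  intro H K _ _ _ _ _ _ π ρ
  rw [map_mul]
  exact (ContinuousLinearMap.opNorm_comp_le _ _).trans
    (mul_le_mul (norm_tensorRep_le π ρ x) (norm_tensorRep_le π ρ y)
      (ContinuousLinearMap.opNorm_nonneg _) (spatialNorm_nonneg _))

theorem spatialNorm_le_sqrt (x : A ⊗[ℂ] B) :
    spatialNorm x ≤ √(spatialNorm (star x * x)) := by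
  refine spatialNorm_le (Real.sqrt_nonneg _) ?_
  intro H K _ _ _ _ _ _ π ρ
  refine Real.le_sqrt_of_sq_le ?_
  rw [sq]
  exact (norm_tensorRep_star_mul_self π ρ x).trans (norm_tensorRep_le π ρ _)

theorem spatialNorm_mul_self_le (x : A ⊗[ℂ] B) :
    spatialNorm x * spatialNorm x ≤ spatialNorm (star x * x) := by
  calc _ ≤ √(spatialNorm (star x * x)) * √(spatialNorm (star x * x)) :=
        mul_self_le_mul_self (spatialNorm_nonneg _) (spatialNorm_le_sqrt x)
    _ = _ := Real.mul_self_sqrt (spatialNorm_nonneg _)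

theorem spatialNorm_le_star (x : A ⊗[ℂ] B) : spatialNorm x ≤ spatialNorm (star x) := by
  have h1 := (spatialNorm_mul_self_le x).trans (spatialNorm_mul_le (star x) x)
  rcases (spatialNorm_nonneg x).eq_or_lt with h | h
  · rw [← h]; exact spatialNorm_nonneg _
  · exact le_of_mul_le_mul_right h1 h

variable (A B) in
/-- The minimal C*-norm, with its properties. -/
def spatialSeminorm : CStarSeminorm (A ⊗[ℂ] B) where
  toFun := spatialNorm
  nonneg := spatialNorm_nonneg
  add_le x y := by
    refine spatialNorm_le (add_nonneg (spatialNorm_nonneg _) (spatialNorm_nonneg _)) ?_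
    intro H K _ _ _ _ _ _ π ρ
    rw [map_add]
    exact (ContinuousLinearMap.opNorm_add_le _ _).trans
      (add_le_add (norm_tensorRep_le π ρ x) (norm_tensorRep_le π ρ y))
  smul_eq c x := by
    refine le_antisymm (spatialNorm_smul_le c x) ?_
    by_cases hc : c = 0
    · subst hc
      simpa using spatialNorm_nonneg ((0 : ℂ) • x)
    · have h := spatialNorm_smul_le c⁻¹ (c • x)
      rw [smul_smul, inv_mul_cancel₀ hc, one_smul, norm_inv] at h
      have hc' : 0 < ‖c‖ := norm_pos_iff.mpr hc
      calc ‖c‖ * spatialNorm x ≤ ‖c‖ * (‖c‖⁻¹ * spatialNorm (c • x)) := by gcongr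
        _ = spatialNorm (c • x) := by field_simp
  mul_le := spatialNorm_mul_le
  star_mul_self x := by
    refine le_antisymm ?_ (spatialNorm_mul_self_le x)
    refine (spatialNorm_mul_le _ _).trans ?_
    refine mul_le_mul_of_nonneg_right ?_ (spatialNorm_nonneg _)
    simpa using spatialNorm_le_star (star x)

end SpatialNorm

/-- The minimal C*-tensor product of two unital C*-algebras: the completion of the algebraic tensor
product for the minimal C*-norm. -/
abbrev MinTensor (A B : Type u) [CStarAlgebra A] [CStarAlgebra B] : Type u :=
  (spatialSeminorm A B).Completion

namespace MinTensor

variable {A B A' B' : Type u} [CStarAlgebra A] [CStarAlgebra B] [CStarAlgebra A'] [CStarAlgebra B']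

/-- The elementary tensor `a ⊗ b`. -/
def tmul (a : A) (b : B) : MinTensor A B := (spatialSeminorm A B).ofHom (a ⊗ₜ[ℂ] b)

theorem tmul_mul_tmul (a a' : A) (b b' : B) :
    tmul a b * tmul a' b' = tmul (a * a') (b * b') := by
  rw [tmul, tmul, ← map_mul, Algebra.TensorProduct.tmul_mul_tmul, tmul]

theorem star_tmul (a : A) (b : B) : star (tmul a b) = tmul (star a) (star b) := by
  rw [tmul, ← map_star, TensorProduct.star_tmul, tmul]

theorem one_eq_tmul : (1 : MinTensor A B) = tmul 1 1 := by
  rw [tmul, ← Algebra.TensorProduct.one_def, map_one]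

theorem tmul_sum {ι : Type*} (s : Finset ι) (a : A) (b : ι → B) :
    tmul a (∑ i ∈ s, b i) = ∑ i ∈ s, tmul a (b i) := by
  simp only [tmul, TensorProduct.tmul_sum, map_sum]

theorem sum_tmul {ι : Type*} (s : Finset ι) (a : ι → A) (b : B) :
    tmul (∑ i ∈ s, a i) b = ∑ i ∈ s, tmul (a i) b := by
  simp only [tmul, TensorProduct.sum_tmul, map_sum]

theorem add_tmul (a a' : A) (b : B) : tmul (a + a') b = tmul a b + tmul a' b := by
  simp only [tmul, TensorProduct.add_tmul, map_add]

theorem smul_tmul (c : ℂ) (a : A) (b : B) : tmul (c • a) b = c • tmul a b := by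
  rw [tmul, ← TensorProduct.smul_tmul', map_smul, tmul]

theorem zero_tmul (b : B) : tmul (0 : A) b = 0 := by
  rw [tmul, TensorProduct.zero_tmul, map_zero]

theorem tmul_zero (a : A) : tmul a (0 : B) = 0 := by
  rw [tmul, TensorProduct.tmul_zero, map_zero]

/-- The algebraic tensor product of two `*`-homomorphisms. -/
def algMap (f : A →⋆ₐ[ℂ] A') (g : B →⋆ₐ[ℂ] B') : (A ⊗[ℂ] B) →⋆ₐ[ℂ] (A' ⊗[ℂ] B') where
  __ := Algebra.TensorProduct.map f.toAlgHom g.toAlgHom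
  map_star' x := by
    change Algebra.TensorProduct.map f.toAlgHom g.toAlgHom (star x)
      = star (Algebra.TensorProduct.map f.toAlgHom g.toAlgHom x)
    induction x using TensorProduct.induction_on with
    | zero => simp
    | add x y hx hy => rw [star_add, map_add, map_add, hx, hy, star_add]
    | tmul a b =>
      rw [TensorProduct.star_tmul, Algebra.TensorProduct.map_tmul, Algebra.TensorProduct.map_tmul,
        TensorProduct.star_tmul]
      exact congrArg₂ _ (map_star f a) (map_star g b)

theorem algMap_tmul (f : A →⋆ₐ[ℂ] A') (g : B →⋆ₐ[ℂ] B') (a : A) (b : B) :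
    algMap f g (a ⊗ₜ b) = f a ⊗ₜ g b := rfl

theorem spatialNorm_algMap_le (f : A →⋆ₐ[ℂ] A') (g : B →⋆ₐ[ℂ] B') (x : A ⊗[ℂ] B) :
    spatialNorm (algMap f g x) ≤ spatialNorm x := by
  refine spatialNorm_le (spatialNorm_nonneg _) ?_
  intro H K _ _ _ _ _ _ π ρ
  have h : tensorRep π ρ (algMap f g x) = tensorRep (π.comp f) (ρ.comp g) x := by
    induction x using TensorProduct.induction_on with
    | zero => simp
    | add x y hx hy => rw [map_add, map_add, map_add, hx, hy]
    | tmul a b => rfl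
  rw [h]
  exact norm_tensorRep_le _ _ x

/-- The tensor product `f ⊗ g` of two `*`-homomorphisms, as a `*`-homomorphism between the minimal
tensor products. -/
def map (f : A →⋆ₐ[ℂ] A') (g : B →⋆ₐ[ℂ] B') : MinTensor A B →⋆ₐ[ℂ] MinTensor A' B' :=
  (spatialSeminorm A B).lift ((spatialSeminorm A' B').ofHom.comp (algMap f g)) fun x => by
    rw [StarAlgHom.comp_apply, CStarSeminorm.norm_ofHom]
    exact spatialNorm_algMap_le f g x

theorem map_tmul (f : A →⋆ₐ[ℂ] A') (g : B →⋆ₐ[ℂ] B') (a : A) (b : B) :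
    map f g (tmul a b) = tmul (f a) (g b) := by
  rw [map, tmul, CStarSeminorm.lift_ofHom]
  rfl

/-- The graph of the canonical isomorphism `(A ⊗ B) ⊗ C ≅ A ⊗ (B ⊗ C)`, which is the isometry
with `(a ⊗ b) ⊗ c ↦ a ⊗ (b ⊗ c)`: the closed linear span of the pairs
`((a ⊗ b) ⊗ c, a ⊗ (b ⊗ c))`. -/
def assocGraph (A B C : Type u) [CStarAlgebra A] [CStarAlgebra B] [CStarAlgebra C] :
    Set (MinTensor (MinTensor A B) C × MinTensor A (MinTensor B C)) :=
  closure (Submodule.span ℂ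
    {z | ∃ (a : A) (b : B) (c : C), z = (tmul (tmul a b) c, tmul a (tmul b c))} :
      Set (MinTensor (MinTensor A B) C × MinTensor A (MinTensor B C)))

end MinTensor

/-! ### Compact quantum groups and their actions -/

open MinTensor (tmul assocGraph tmul_mul_tmul star_tmul one_eq_tmul tmul_sum sum_tmul add_tmul
  smul_tmul zero_tmul tmul_zero)

/-- `(A, Δ)` is a compact quantum group: `(Δ ⊗ id) Δ = (id ⊗ Δ) Δ`, under the identification
of `(A ⊗ A) ⊗ A` with `A ⊗ (A ⊗ A)`, and both `Δ(A)(1 ⊗ A)` and `Δ(A)(A ⊗ 1)` (linear spans of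
products) are dense in `A ⊗ A`. -/
structure IsCompactQuantumGroup {A : Type u} [CStarAlgebra A]
    (Δ : A →⋆ₐ[ℂ] MinTensor A A) : Prop where
  coassoc : ∀ a, (MinTensor.map Δ (StarAlgHom.id ℂ A) (Δ a),
    MinTensor.map (StarAlgHom.id ℂ A) Δ (Δ a)) ∈ assocGraph A A A
  dense_right : Dense (Submodule.span ℂ {z | ∃ a b : A, z = Δ a * tmul 1 b} :
    Set (MinTensor A A))
  dense_left : Dense (Submodule.span ℂ {z | ∃ a b : A, z = Δ a * tmul b 1} :
    Set (MinTensor A A))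

/-- `α` is an action of the compact quantum group `(A, Δ)` on the unital C*-algebra `B`:
`(α ⊗ id) α = (id ⊗ Δ) α`, under the identification of `(B ⊗ A) ⊗ A` with `B ⊗ (A ⊗ A)`, and
`α(B)(1 ⊗ A)` is dense in `B ⊗ A`. -/
structure IsQuantumAction {A B : Type u} [CStarAlgebra A] [CStarAlgebra B]
    (Δ : A →⋆ₐ[ℂ] MinTensor A A) (α : B →⋆ₐ[ℂ] MinTensor B A) : Prop where
  coaction : ∀ b, (MinTensor.map α (StarAlgHom.id ℂ A) (α b),
    MinTensor.map (StarAlgHom.id ℂ B) Δ (α b)) ∈ assocGraph B A A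
  dense : Dense (Submodule.span ℂ {z | ∃ (b : B) (a : A), z = α b * tmul 1 a} :
    Set (MinTensor B A))

/-- `α` is faithful: if a unital C*-subalgebra `Q` of `A` is a compact quantum quotient group of
`(A, Δ)` (`Δ` restricts to a comultiplication `ΔQ : Q → Q ⊗ Q` that makes `Q` a compact quantum
group) and `α` is induced by an action `αQ : B → B ⊗ Q` of `(Q, ΔQ)`, then `Q = A`. -/
def IsFaithfulAction {A B : Type u} [CStarAlgebra A] [CStarAlgebra B]
    (Δ : A →⋆ₐ[ℂ] MinTensor A A) (α : B →⋆ₐ[ℂ] MinTensor B A) : Prop :=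
  ∀ (Q : StarSubalgebra ℂ A) [IsClosed (Q : Set A)]
    (ΔQ : Q →⋆ₐ[ℂ] MinTensor Q Q) (αQ : B →⋆ₐ[ℂ] MinTensor B Q),
    (∀ q : Q, MinTensor.map Q.subtype Q.subtype (ΔQ q) = Δ (q : A)) →
    IsCompactQuantumGroup ΔQ →
    (∀ b : B, MinTensor.map (StarAlgHom.id ℂ B) Q.subtype (αQ b) = α b) →
    IsQuantumAction ΔQ αQ →
    Q = ⊤

/-! ### Quantum permutation groups -/

/-- The relations of the generators of the quantum permutation group: all `u i j` are projections,
and every row and every column sums up to `1`. -/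
structure IsMagicUnitary {n : ℕ} {D : Type*} [Ring D] [StarRing D] (u : Fin n → Fin n → D) :
    Prop where
  star_eq : ∀ i j, star (u i j) = u i j
  mul_self : ∀ i j, u i j * u i j = u i j
  sum_col : ∀ j, ∑ i, u i j = 1
  sum_row : ∀ i, ∑ j, u i j = 1

namespace IsMagicUnitary

variable {n : ℕ} {D : Type*} [CStarAlgebra D] {u : Fin n → Fin n → D}

theorem norm_le (hu : IsMagicUnitary u) (i j : Fin n) : ‖u i j‖ ≤ 1 := by
  have h := CStarRing.norm_star_mul_self (x := u i j)
  rw [hu.star_eq, hu.mul_self] at h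
  by_contra! h1
  nlinarith

theorem mul_eq_zero_of_sum {ι : Type*} [Fintype ι] [DecidableEq ι] {v : ι → D}
    (hs : ∀ i, star (v i) = v i) (hm : ∀ i, v i * v i = v i) (h1 : ∑ i, v i = 1)
    {i j : ι} (hij : i ≠ j) : v i * v j = 0 := by
  let := CStarAlgebra.spectralOrder D
  have := CStarAlgebra.spectralOrderedRing D
  have hsum : ∑ k, star (v k * v j) * (v k * v j) = v j := by
    have : ∀ k, star (v k * v j) * (v k * v j) = v j * v k * v j := by
      intro k
      rw [star_mul, hs, hs, mul_assoc, ← mul_assoc (v k) (v k), hm, mul_assoc]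
    simp_rw [this]
    rw [← Finset.sum_mul, ← Finset.mul_sum, h1, mul_one, hm]
  rw [← Finset.add_sum_erase _ _ (Finset.mem_univ j), hm, hs, hm] at hsum
  have h0 : ∑ k ∈ Finset.univ.erase j, star (v k * v j) * (v k * v j) = 0 := by
    simpa using hsum
  rw [Finset.sum_eq_zero_iff_of_nonneg fun k _ => star_mul_self_nonneg _] at h0
  exact (CStarRing.star_mul_self_eq_zero_iff _).mp
    (h0 i (Finset.mem_erase.mpr ⟨hij, Finset.mem_univ _⟩))

theorem mul_row (hu : IsMagicUnitary u) (k i j : Fin n) :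
    u k i * u k j = if i = j then u k i else 0 := by
  split_ifs with h
  · subst h; exact hu.mul_self _ _
  · exact mul_eq_zero_of_sum (v := fun i => u k i) (fun i => hu.star_eq k i)
      (fun i => hu.mul_self k i) (hu.sum_row k) h

theorem mul_col (hu : IsMagicUnitary u) (k i j : Fin n) :
    u i k * u j k = if i = j then u i k else 0 := by
  split_ifs with h
  · subst h; exact hu.mul_self _ _
  · exact mul_eq_zero_of_sum (v := fun i => u i k) (fun i => hu.star_eq i k)
      (fun i => hu.mul_self i k) (hu.sum_col k) h

end IsMagicUnitary

/-- The free unital complex `*`-algebra on self-adjoint generators indexed by `X`: the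
complexification of the free real algebra on `X` with the involution that reverses words. -/
abbrev FreeStar (X : Type u) : Type u := ℂ ⊗[ℝ] FreeAlgebra ℝ X

namespace FreeStar

variable {X : Type u}

instance : StarModule ℝ (FreeAlgebra ℝ X) where
  star_smul r x := by
    rw [Algebra.smul_def, star_mul, FreeAlgebra.star_algebraMap, Algebra.smul_def]
    exact (Algebra.commutes _ _).symm

instance : StarModule ℂ (FreeStar X) where
  star_smul c x := by
    induction x using TensorProduct.induction_on with
    | zero => simp
    | add x y hx hy => rw [smul_add, star_add, hx, hy, star_add, smul_add]
    | tmul z w =>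
      rw [TensorProduct.smul_tmul', TensorProduct.star_tmul, TensorProduct.star_tmul,
        TensorProduct.smul_tmul', star_smul]

/-- The generators. -/
def gen (x : X) : FreeStar X := 1 ⊗ₜ FreeAlgebra.ι ℝ x

variable {D : Type*} [CStarAlgebra D]

theorem lift_star (u : X → D) (hu : ∀ x, star (u x) = u x) (w : FreeAlgebra ℝ X) :
    FreeAlgebra.lift ℝ u (star w) = star (FreeAlgebra.lift ℝ u w) := by
  induction w using FreeAlgebra.induction with
  | grade0 r =>
    rw [FreeAlgebra.star_algebraMap, AlgHom.commutes, Algebra.algebraMap_eq_smul_one, star_smul,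
      star_one, star_trivial]
  | grade1 x => rw [FreeAlgebra.star_ι, FreeAlgebra.lift_ι_apply, hu]
  | mul a b ha hb => rw [star_mul, map_mul, map_mul, ha, hb, star_mul]
  | add a b ha hb => rw [star_add, map_add, map_add, ha, hb, star_add]

/-- The `*`-homomorphism that sends the generators to given self-adjoint elements. -/
def lift (u : X → D) (hu : ∀ x, star (u x) = u x) : FreeStar X →⋆ₐ[ℂ] D where
  __ := AlgHom.liftEquiv ℝ ℂ (FreeAlgebra ℝ X) D (FreeAlgebra.lift ℝ u)
  map_star' x := by
    change AlgHom.liftEquiv ℝ ℂ (FreeAlgebra ℝ X) D (FreeAlgebra.lift ℝ u) (star x)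
      = star (AlgHom.liftEquiv ℝ ℂ (FreeAlgebra ℝ X) D (FreeAlgebra.lift ℝ u) x)
    induction x using TensorProduct.induction_on with
    | zero => simp
    | add x y hx hy => rw [star_add, map_add, map_add, hx, hy, star_add]
    | tmul z w =>
      rw [TensorProduct.star_tmul, AlgHom.liftEquiv_tmul, AlgHom.liftEquiv_tmul,
        lift_star u hu, star_smul]

theorem lift_tmul (u : X → D) (hu : ∀ x, star (u x) = u x) (z : ℂ) (w : FreeAlgebra ℝ X) :
    lift u hu (z ⊗ₜ w) = z • FreeAlgebra.lift ℝ u w := rfl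

theorem lift_gen (u : X → D) (hu : ∀ x, star (u x) = u x) (x : X) :
    lift u hu (gen x) = u x := by
  rw [gen, lift_tmul, FreeAlgebra.lift_ι_apply, one_smul]

end FreeStar

namespace QPerm

/-- The index set of the generators of the quantum permutation group. -/
abbrev Idx (n : ℕ) : Type u := ULift.{u} (Fin n × Fin n)

/-- The `*`-homomorphism of the free `*`-algebra given by a magic unitary. -/
def freeHom {n : ℕ} {D : Type u} [CStarAlgebra D] {u : Fin n → Fin n → D}
    (hu : IsMagicUnitary u) : FreeStar (Idx.{u} n) →⋆ₐ[ℂ] D :=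
  FreeStar.lift (fun x => u x.down.1 x.down.2) fun _ => hu.star_eq _ _

theorem norm_one_le (D : Type u) [CStarAlgebra D] : ‖(1 : D)‖ ≤ 1 := by
  have h := CStarRing.norm_star_mul_self (x := (1 : D))
  rw [star_one, one_mul] at h
  by_contra! h1
  nlinarith

theorem exists_bound {n : ℕ} (x : FreeStar (Idx.{u} n)) :
    ∃ C : ℝ, 0 ≤ C ∧ ∀ (D : Type u) [CStarAlgebra D] (u : Fin n → Fin n → D)
      (hu : IsMagicUnitary u), ‖freeHom hu x‖ ≤ C := by
  induction x using TensorProduct.induction_on with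
  | zero => exact ⟨0, le_rfl, by intros; simp⟩
  | add x y hx hy =>
    obtain ⟨C, h0, hC⟩ := hx
    obtain ⟨C', h0', hC'⟩ := hy
    refine ⟨C + C', add_nonneg h0 h0', ?_⟩
    intro D _ u hu
    rw [map_add]
    exact (norm_add_le _ _).trans (add_le_add (hC D u hu) (hC' D u hu))
  | tmul z w =>
    suffices h : ∃ C : ℝ, 0 ≤ C ∧ ∀ (D : Type u) [CStarAlgebra D] (u : Fin n → Fin n → D)
        (_ : IsMagicUnitary u),
        ‖FreeAlgebra.lift ℝ (fun x : Idx.{u} n => u x.down.1 x.down.2) w‖ ≤ C by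
      obtain ⟨C, h0, hC⟩ := h
      refine ⟨‖z‖ * C, by positivity, ?_⟩
      intro D _ u hu
      rw [freeHom, FreeStar.lift_tmul, norm_smul]
      gcongr
      exact hC D u hu
    induction w using FreeAlgebra.induction with
    | grade0 r =>
      refine ⟨‖r‖, norm_nonneg _, ?_⟩
      intro D _ u hu
      rw [AlgHom.commutes, Algebra.algebraMap_eq_smul_one, norm_smul]
      exact mul_le_of_le_one_right (norm_nonneg _) (norm_one_le D)
    | grade1 x =>
      refine ⟨1, zero_le_one, ?_⟩
      intro D _ u hu
      rw [FreeAlgebra.lift_ι_apply]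
      exact hu.norm_le _ _
    | mul a b ha hb =>
      obtain ⟨C, h0, hC⟩ := ha
      obtain ⟨C', h0', hC'⟩ := hb
      refine ⟨C * C', mul_nonneg h0 h0', ?_⟩
      intro D _ u hu
      rw [map_mul]
      exact (norm_mul_le _ _).trans
        (mul_le_mul (hC D u hu) (hC' D u hu) (norm_nonneg _) h0)
    | add a b ha hb =>
      obtain ⟨C, h0, hC⟩ := ha
      obtain ⟨C', h0', hC'⟩ := hb
      refine ⟨C + C', add_nonneg h0 h0', ?_⟩
      intro D _ u hu
      rw [map_add]
      exact (norm_add_le _ _).trans (add_le_add (hC D u hu) (hC' D u hu))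

/-- The norms of the images of `x` under all magic unitaries in C*-algebras. -/
def normSet {n : ℕ} (x : FreeStar (Idx.{u} n)) : Set ℝ :=
  {r | ∃ (D : Type u) (_ : CStarAlgebra D) (u : Fin n → Fin n → D) (hu : IsMagicUnitary u),
    r = ‖freeHom hu x‖}

/-- The universal C*-seminorm of the relations of a magic unitary: the supremum of the norms of the
images of `x` in all C*-algebras with `n ^ 2` elements that satisfy the relations. -/
def univNorm {n : ℕ} (x : FreeStar (Idx.{u} n)) : ℝ := sSup (normSet x)

variable {n : ℕ}

theorem norm_freeHom_le {D : Type u} [CStarAlgebra D] {u : Fin n → Fin n → D}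
    (hu : IsMagicUnitary u) (x : FreeStar (Idx.{u} n)) : ‖freeHom hu x‖ ≤ univNorm x := by
  obtain ⟨C, -, hC⟩ := exists_bound x
  refine le_csSup ⟨C, ?_⟩ ⟨D, _, u, hu, rfl⟩
  rintro r ⟨D, _, u, hu, rfl⟩
  exact hC D u hu

theorem univNorm_nonneg (x : FreeStar (Idx.{u} n)) : 0 ≤ univNorm x := by
  refine Real.sSup_nonneg ?_
  rintro r ⟨D, _, u, hu, rfl⟩
  exact norm_nonneg _

theorem univNorm_le {x : FreeStar (Idx.{u} n)} {C : ℝ} (hC : 0 ≤ C)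
    (h : ∀ (D : Type u) [CStarAlgebra D] (u : Fin n → Fin n → D) (hu : IsMagicUnitary u),
      ‖freeHom hu x‖ ≤ C) : univNorm x ≤ C := by
  refine Real.sSup_le ?_ hC
  rintro r ⟨D, _, u, hu, rfl⟩
  exact h D u hu

theorem univNorm_mul_le (x y : FreeStar (Idx.{u} n)) :
    univNorm (x * y) ≤ univNorm x * univNorm y := by
  refine univNorm_le (mul_nonneg (univNorm_nonneg _) (univNorm_nonneg _)) ?_
  intro D _ u hu
  rw [map_mul]
  exact (norm_mul_le _ _).trans (mul_le_mul (norm_freeHom_le hu x) (norm_freeHom_le hu y)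
    (norm_nonneg _) (univNorm_nonneg _))

theorem univNorm_star_le (x : FreeStar (Idx.{u} n)) : univNorm (star x) ≤ univNorm x := by
  refine univNorm_le (univNorm_nonneg _) ?_
  intro D _ u hu
  rw [map_star, norm_star]
  exact norm_freeHom_le hu x

/-- The universal C*-seminorm, with its properties. -/
def univSeminorm (n : ℕ) : CStarSeminorm (FreeStar (Idx.{u} n)) where
  toFun := univNorm
  nonneg := univNorm_nonneg
  add_le x y := by
    refine univNorm_le (add_nonneg (univNorm_nonneg _) (univNorm_nonneg _)) ?_
    intro D _ u hu
    rw [map_add]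
    exact (norm_add_le _ _).trans (add_le_add (norm_freeHom_le hu x) (norm_freeHom_le hu y))
  smul_eq c x := by
    have key : ∀ (c : ℂ) (x : FreeStar (Idx.{u} n)), univNorm (c • x) ≤ ‖c‖ * univNorm x := by
      intro c x
      refine univNorm_le (mul_nonneg (norm_nonneg _) (univNorm_nonneg _)) ?_
      intro D _ u hu
      rw [map_smul, norm_smul]
      exact mul_le_mul_of_nonneg_left (norm_freeHom_le hu x) (norm_nonneg _)
    refine le_antisymm (key c x) ?_
    by_cases hc : c = 0
    · subst hc
      simpa using univNorm_nonneg ((0 : ℂ) • x)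
    · have h := key c⁻¹ (c • x)
      rw [smul_smul, inv_mul_cancel₀ hc, one_smul, norm_inv] at h
      have hc' : 0 < ‖c‖ := norm_pos_iff.mpr hc
      calc ‖c‖ * univNorm x ≤ ‖c‖ * (‖c‖⁻¹ * univNorm (c • x)) := by gcongr
        _ = univNorm (c • x) := by field_simp
  mul_le := univNorm_mul_le
  star_mul_self x := by
    refine le_antisymm ((univNorm_mul_le _ _).trans
      (mul_le_mul_of_nonneg_right (univNorm_star_le x) (univNorm_nonneg _))) ?_
    have h : univNorm x ≤ √(univNorm (star x * x)) := by
      refine univNorm_le (Real.sqrt_nonneg _) ?_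
      intro D _ u hu
      refine Real.le_sqrt_of_sq_le ?_
      rw [sq, ← CStarRing.norm_star_mul_self, ← map_star, ← map_mul]
      exact norm_freeHom_le hu _
    calc _ ≤ √(univNorm (star x * x)) * √(univNorm (star x * x)) :=
          mul_self_le_mul_self (univNorm_nonneg _) h
      _ = _ := Real.mul_self_sqrt (univNorm_nonneg _)

theorem norm_freeHom_le_univSeminorm {D : Type u} [CStarAlgebra D] {u : Fin n → Fin n → D}
    (hu : IsMagicUnitary u) (x : FreeStar (Idx.{u} n)) :
    ‖freeHom hu x‖ ≤ (univSeminorm n).toFun x :=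
  norm_freeHom_le hu x

end QPerm

/-- The C*-algebra `A_n` of the quantum permutation group: the universal C*-algebra generated by
the entries of an `n × n` magic unitary. -/
abbrev QPerm (n : ℕ) : Type u := (QPerm.univSeminorm.{u} n).Completion

namespace QPerm

variable {n : ℕ}

/-- The generators `a_ij` of `A_n`. -/
def gen (i j : Fin n) : QPerm.{u} n := (univSeminorm n).ofHom (FreeStar.gen ⟨(i, j)⟩)

theorem eq_of_univNorm {x y : FreeStar (Idx.{u} n)}
    (h : ∀ (D : Type u) [CStarAlgebra D] (u : Fin n → Fin n → D) (hu : IsMagicUnitary u),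
      freeHom hu x = freeHom hu y) :
    (univSeminorm n).ofHom x = (univSeminorm n).ofHom y := by
  rw [← sub_eq_zero, ← map_sub, ← norm_eq_zero, CStarSeminorm.norm_ofHom]
  refine le_antisymm (univNorm_le le_rfl ?_) (univNorm_nonneg _)
  intro D _ u hu
  rw [map_sub, h D u hu, sub_self, norm_zero]

theorem freeHom_gen {D : Type u} [CStarAlgebra D] {u : Fin n → Fin n → D}
    (hu : IsMagicUnitary u) (i j : Fin n) : freeHom hu (FreeStar.gen ⟨(i, j)⟩) = u i j :=
  FreeStar.lift_gen _ _ _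

theorem isMagicUnitary_gen : IsMagicUnitary (gen (n := n) : Fin n → Fin n → QPerm.{u} n) where
  star_eq i j := by
    rw [gen, ← map_star]
    refine eq_of_univNorm fun D _ u hu => ?_
    rw [map_star, freeHom_gen, hu.star_eq]
  mul_self i j := by
    rw [gen, ← map_mul]
    refine eq_of_univNorm fun D _ u hu => ?_
    rw [map_mul, freeHom_gen, hu.mul_self]
  sum_col j := by
    simp only [gen]
    rw [← map_sum, ← map_one (univSeminorm n).ofHom]
    refine eq_of_univNorm fun D _ u hu => ?_
    simp only [map_sum, freeHom_gen, hu.sum_col, map_one]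
  sum_row i := by
    simp only [gen]
    rw [← map_sum, ← map_one (univSeminorm n).ofHom]
    refine eq_of_univNorm fun D _ u hu => ?_
    simp only [map_sum, freeHom_gen, hu.sum_row, map_one]

/-- The universal property of `A_n`: a magic unitary in a C*-algebra `D` gives a
`*`-homomorphism `A_n → D`. -/
def lift {D : Type u} [CStarAlgebra D] {u : Fin n → Fin n → D} (hu : IsMagicUnitary u) :
    QPerm.{u} n →⋆ₐ[ℂ] D :=
  (univSeminorm n).lift (freeHom hu) (norm_freeHom_le_univSeminorm hu)

theorem lift_gen {D : Type u} [CStarAlgebra D] {u : Fin n → Fin n → D} (hu : IsMagicUnitary u)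
    (i j : Fin n) : lift hu (gen i j) = u i j := by
  rw [lift, gen, CStarSeminorm.lift_ofHom, freeHom_gen]

theorem isMagicUnitary_comul : IsMagicUnitary
    (fun i j : Fin n => ∑ k, tmul (gen.{u} i k) (gen.{u} k j)) where
  star_eq i j := by
    simp only [star_sum, star_tmul, isMagicUnitary_gen.star_eq]
  mul_self i j := by
    rw [Finset.sum_mul_sum]
    refine Finset.sum_congr rfl fun k _ => ?_
    rw [Finset.sum_eq_single k]
    · rw [tmul_mul_tmul, isMagicUnitary_gen.mul_self, isMagicUnitary_gen.mul_self]
    · intro l _ hl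
      rw [tmul_mul_tmul, isMagicUnitary_gen.mul_row, if_neg hl.symm, zero_tmul]
    · simp
  sum_col j := by
    rw [Finset.sum_comm]
    simp only [← sum_tmul, isMagicUnitary_gen.sum_col, ← tmul_sum]
    exact one_eq_tmul.symm
  sum_row i := by
    rw [Finset.sum_comm]
    simp only [← tmul_sum, isMagicUnitary_gen.sum_row, ← sum_tmul]
    exact one_eq_tmul.symm

/-- The comultiplication `Δ_n` of the quantum permutation group, the `*`-homomorphism with
`Δ_n (a_ij) = ∑ k, a_ik ⊗ a_kj`. -/
def comul (n : ℕ) : QPerm.{u} n →⋆ₐ[ℂ] MinTensor (QPerm.{u} n) (QPerm.{u} n) :=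
  lift isMagicUnitary_comul

theorem comul_gen (i j : Fin n) :
    comul n (gen.{u} i j) = ∑ k, tmul (gen.{u} i k) (gen.{u} k j) :=
  lift_gen _ _ _

end QPerm

/-! ### The action on `X_n × Y`, and the quotient -/

section Action

variable (n : ℕ) (Y : Type u) [TopologicalSpace Y] [CompactSpace Y]

variable {Y} in
/-- The function `e_i ⊗ f` on `X_n × Y`, where `X_n = {x_1, …, x_n}` is the finite discrete space
`Fin n`: its value at `(x_j, y)` is `f y` if `j = i`, and `0` otherwise. -/
def sheet {n : ℕ} (i : Fin n) (f : C(Y, ℂ)) : C(Fin n × Y, ℂ) where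
  toFun p := if p.1 = i then f p.2 else 0
  continuous_toFun := by
    have h : Continuous fun j : Fin n => (if j = i then (1 : ℂ) else 0) :=
      continuous_of_discreteTopology
    have h2 : Continuous fun p : Fin n × Y => (if p.1 = i then (1 : ℂ) else 0) * f p.2 :=
      (h.comp continuous_fst).mul (f.continuous.comp continuous_snd)
    refine h2.congr fun p => ?_
    simp

variable {Y} in
/-- The function `F (x_i, ·)` on `Y`. -/
def slice {n : ℕ} (i : Fin n) (F : C(Fin n × Y, ℂ)) : C(Y, ℂ) :=
  F.comp ⟨fun y => (i, y), by fun_prop⟩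

/-- The action `α` of `A_n` on `X_n × Y`, the `*`-homomorphism with
`α (e_i ⊗ f) = ∑ k, e_k ⊗ f ⊗ a_ki`. Every `F` is `∑ i, e_i ⊗ F (x_i, ·)`. -/
def prodAction : C(Fin n × Y, ℂ) →⋆ₐ[ℂ] MinTensor C(Fin n × Y, ℂ) (QPerm.{u} n) where
  toFun F := ∑ i, ∑ k, tmul (sheet k (slice i F)) (QPerm.gen k i)
  map_one' := by
    rw [Finset.sum_comm]
    have h : ∀ i k : Fin n, sheet k (slice i (1 : C(Fin n × Y, ℂ))) = sheet k 1 := fun _ _ => rfl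
    simp only [h, ← tmul_sum, QPerm.isMagicUnitary_gen.sum_row, ← sum_tmul]
    rw [one_eq_tmul]
    congr 1
    ext p
    simp [sheet]
  map_mul' F G := by
    have h1 : ∀ k i j : Fin n, sheet k (slice i F) * sheet k (slice j G)
        = sheet k (slice i F * slice j G) := by
      intro k i j
      ext p
      by_cases h : p.1 = k <;> simp [sheet, h]
    have h2 : ∀ k l i j : Fin n, l ≠ k → sheet k (slice i F) * sheet l (slice j G) = 0 := by
      intro k l i j hkl
      ext p
      simp only [sheet, ContinuousMap.mul_apply, ContinuousMap.coe_mk, ContinuousMap.zero_apply]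
      split_ifs with h h' <;> simp_all
    rw [Finset.sum_mul_sum]
    refine Finset.sum_congr rfl fun i _ => ?_
    symm
    rw [Finset.sum_eq_single i]
    · rw [Finset.sum_mul_sum]
      refine Finset.sum_congr rfl fun k _ => ?_
      rw [Finset.sum_eq_single k]
      · rw [tmul_mul_tmul, h1, QPerm.isMagicUnitary_gen.mul_self]
        rfl
      · intro l _ hl
        rw [tmul_mul_tmul, h2 _ _ _ _ hl, zero_tmul]
      · simp
    · intro j _ hj
      rw [Finset.sum_mul_sum]
      refine Finset.sum_eq_zero fun k _ => Finset.sum_eq_zero fun l _ => ?_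
      rw [tmul_mul_tmul]
      by_cases hkl : l = k
      · subst hkl
        rw [QPerm.isMagicUnitary_gen.mul_row, if_neg hj.symm, tmul_zero]
      · rw [h2 _ _ _ _ hkl, zero_tmul]
    · simp
  map_zero' := by
    have h : ∀ i k : Fin n, sheet k (slice i (0 : C(Fin n × Y, ℂ))) = 0 := by
      intro i k
      ext p
      simp [sheet, slice]
    simp only [h, zero_tmul, Finset.sum_const_zero]
  map_add' F G := by
    have h : ∀ i k : Fin n, sheet k (slice i (F + G))
        = sheet k (slice i F) + sheet k (slice i G) := by
      intro i k
      ext p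
      simp only [sheet, slice, ContinuousMap.add_apply, ContinuousMap.coe_mk,
        ContinuousMap.comp_apply]
      split_ifs <;> simp
    simp only [h, add_tmul, Finset.sum_add_distrib]
  commutes' c := by
    have h : ∀ i k : Fin n, sheet k (slice i (algebraMap ℂ C(Fin n × Y, ℂ) c))
        = c • sheet k 1 := by
      intro i k
      ext p
      simp [sheet, slice]
    rw [Finset.sum_comm]
    simp only [h, ← tmul_sum, QPerm.isMagicUnitary_gen.sum_row, ← sum_tmul]
    rw [Algebra.algebraMap_eq_smul_one, one_eq_tmul, ← Finset.smul_sum, smul_tmul]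
    congr 2
    ext p
    simp [sheet]
  map_star' F := by
    have h : ∀ i k : Fin n, sheet k (slice i (star F)) = star (sheet k (slice i F)) := by
      intro i k
      ext p
      simp only [sheet, slice, ContinuousMap.star_apply, ContinuousMap.coe_mk,
        ContinuousMap.comp_apply]
      split_ifs <;> simp
    simp only [h, star_sum, star_tmul, QPerm.isMagicUnitary_gen.star_eq]

theorem prodAction_sheet (i : Fin n) (f : C(Y, ℂ)) :
    prodAction n Y (sheet i f) = ∑ k, tmul (sheet k f) (QPerm.gen k i) := by
  change ∑ j, ∑ k, tmul (sheet k (slice j (sheet i f))) (QPerm.gen k j) = _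
  rw [Finset.sum_eq_single i]
  · refine Finset.sum_congr rfl fun k _ => ?_
    congr 2
    ext y
    simp [sheet, slice]
  · intro j _ hj
    refine Finset.sum_eq_zero fun k _ => ?_
    have h : sheet k (slice j (sheet i f)) = 0 := by
      ext p
      simp [sheet, slice, hj]
    rw [h, zero_tmul]
  · simp

variable {Y}

/-- The equivalence relation on `X_n × Y` that identifies the `n` copies of each point of `Y₁`. -/
def glueSetoid (Y₁ : Set Y) : Setoid (Fin n × Y) where
  r p q := (p.2 = q.2 ∧ p.2 ∈ Y₁) ∨ (p.2 = q.2 ∧ p.1 = q.1)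
  iseqv :=
    { refl := fun _ => Or.inr ⟨rfl, rfl⟩
      symm := by
        rintro p q (⟨h, h'⟩ | ⟨h, h'⟩)
        · exact Or.inl ⟨h.symm, h ▸ h'⟩
        · exact Or.inr ⟨h.symm, h'.symm⟩
      trans := by
        rintro p q r (⟨h, h'⟩ | ⟨h, h'⟩) (⟨k, k'⟩ | ⟨k, k'⟩)
        · exact Or.inl ⟨h.trans k, h'⟩
        · exact Or.inl ⟨h.trans k, h'⟩
        · exact Or.inl ⟨h.trans k, h ▸ k'⟩
        · exact Or.inr ⟨h.trans k, h'.trans k'⟩ }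

/-- The quotient space `(X_n × Y)/∼`, with the quotient topology. -/
abbrev Glued (Y₁ : Set Y) : Type u := Quotient (glueSetoid n Y₁)

/-- The inclusion of `C((X_n × Y)/∼)` in `C(X_n × Y)`: composition with the quotient map. -/
def gluedIncl (Y₁ : Set Y) : C(Glued n Y₁, ℂ) →⋆ₐ[ℂ] C(Fin n × Y, ℂ) :=
  ContinuousMap.compStarAlgHom' ℂ ℂ
    ⟨(Quotient.mk (glueSetoid n Y₁) : Fin n × Y → Glued n Y₁), continuous_quotient_mk'⟩

end Action

end

/-!
The idea of the action on the quotient: fix an index `j` and write `F_i` for the restriction of a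
function `F` on `(X_n × Y)/∼` to the `i`-th copy of `Y`. Then `F` is the sum of `1 ⊗ F_j` and of the
functions `e_i ⊗ (F_i - F_j)`, and `F_i - F_j` vanishes on `Y₁`. Since the rows of a magic unitary
sum up to `1`, the action `α` fixes the first summand, and it sends the others to
`∑ k, e_k ⊗ (F_i - F_j) ⊗ a_ki`, where `e_k ⊗ (F_i - F_j)` is again a function on the quotient. So
`α F` is a finite sum of elementary tensors over functions on the quotient, and this sum defines the
restricted action (`Glued.action`); no injectivity of the minimal tensor product is needed. The
coaction identity and the density condition then follow from the formula
`α (e_k ⊗ G) = ∑ l, e_l ⊗ G ⊗ a_lk` for functions `G` that vanish on `Y₁` (`Glued.action_sheet`).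

Faithfulness: choose `y ∉ Y₁` and `G` with `G = 0` on `Y₁` and `G y = 1`. The slice map at the point
`(x_k, y)` sends `α (e_i ⊗ G)` to `a_ki`, so a closed subalgebra `Q` through which `α` factors
contains all generators (`Glued.isFaithfulAction_action`). The slice map `χ ⊗ id` of a character `χ`
is contractive for the minimal norm because the norm of a C*-algebra is attained in
representations (`exists_rep_norming`), the GNS representations of Hahn–Banach extensions of
characters of commutative subalgebras.

`A_n` is a compact quantum group since the magic unitary relations give
`a_ij ⊗ 1 = ∑ k, Δ(a_ik) (1 ⊗ a_jk)`, and the `a` with `a ⊗ 1` in the span of `Δ(A) (1 ⊗ A)` form a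
subalgebra (`spanPreimage`). It is not commutative for `n ≥ 4`, since two non-commuting projections
`p` and `q` give a magic unitary with the blocks `(p, 1 - p; 1 - p, p)` and
`(q, 1 - q; 1 - q, q)`.
-/

noncomputable section

/-! ### Norming states and representations of a C*-algebra -/

section States

open scoped ComplexOrder

variable {A : Type u} [CStarAlgebra A]

/-- A contractive functional with `f 1 = 1` is real on self-adjoint elements, since the norm of
`x + t i` grows like `√(‖x‖ ^ 2 + t ^ 2)`. -/
theorem im_apply_eq_zero_of_isSelfAdjoint (f : StrongDual ℂ A) (h1 : f 1 = 1) (hf : ‖f‖ ≤ 1)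
    {x : A} (hx : IsSelfAdjoint x) : (f x).im = 0 := by
  have key : ∀ t : ℝ, 2 * t * (f x).im ≤ ‖x‖ ^ 2 := by
    intro t
    set y : A := x + (t * Complex.I) • (1 : A) with hy
    have hfy : f y = f x + t * Complex.I := by simp [hy, h1]
    have hyy : star y * y = x * x + ((t ^ 2 : ℝ) : ℂ) • (1 : A) := by
      have hs : star y = x - (t * Complex.I) • (1 : A) := by
        simp [hy, hx.star_eq, sub_eq_add_neg]
      rw [hs, hy]
      simp only [sub_mul, mul_add, mul_smul_comm, smul_mul_assoc, mul_one, one_mul]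
      have : (t * Complex.I) * (t * Complex.I) = -((t ^ 2 : ℝ) : ℂ) := by
        push_cast
        linear_combination (t : ℂ) ^ 2 * Complex.I_sq
      rw [smul_sub, smul_smul, this, neg_smul]
      abel
    have hn : ‖y‖ ^ 2 ≤ ‖x‖ ^ 2 + t ^ 2 := by
      rw [sq, ← CStarRing.norm_star_mul_self, hyy]
      refine (norm_add_le _ _).trans (add_le_add ((norm_mul_le _ _).trans (sq _).ge) ?_)
      rw [norm_smul, Complex.norm_real, Real.norm_eq_abs, abs_of_nonneg (sq_nonneg t)]
      exact mul_le_of_le_one_right (sq_nonneg t) (QPerm.norm_one_le A)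
    have him : ((f x).im + t) ^ 2 ≤ ‖f y‖ ^ 2 := by
      rw [Complex.sq_norm, Complex.normSq_apply, hfy]
      simp only [Complex.add_re, Complex.add_im, Complex.mul_re, Complex.mul_im, Complex.ofReal_re,
        Complex.ofReal_im, Complex.I_re, Complex.I_im]
      nlinarith [sq_nonneg (f x).re]
    have hle : ‖f y‖ ≤ ‖y‖ := (f.le_opNorm y).trans (mul_le_of_le_one_left (norm_nonneg _) hf)
    have := pow_le_pow_left₀ (norm_nonneg _) hle 2
    nlinarith [sq_nonneg (f x).im]
  by_contra h
  -- for this `t` the left-hand side of `key` is `‖x‖ ^ 2 + 1`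
  have := key ((‖x‖ ^ 2 + 1) / (2 * (f x).im))
  have h2 : 2 * ((‖x‖ ^ 2 + 1) / (2 * (f x).im)) * (f x).im = ‖x‖ ^ 2 + 1 := by field_simp
  linarith

/-- A contractive functional with `f 1 = 1` is positive: for `x ≥ 0` the number `f x` is real, and
`‖‖x‖ - x‖ ≤ ‖x‖` puts it within distance `‖x‖` of `‖x‖`. -/
theorem apply_nonneg_of_norm_le_one [PartialOrder A] [StarOrderedRing A] (f : StrongDual ℂ A)
    (h1 : f 1 = 1) (hf : ‖f‖ ≤ 1) {x : A} (hx : 0 ≤ x) : 0 ≤ f x := by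
  have hsa : IsSelfAdjoint x := .of_nonneg hx
  rw [Complex.nonneg_iff]
  refine ⟨?_, (im_apply_eq_zero_of_isSelfAdjoint f h1 hf hsa).symm⟩
  have hle : ‖algebraMap ℝ A ‖x‖ - x‖ ≤ ‖x‖ := by
    have h0 : 0 ≤ algebraMap ℝ A ‖x‖ - x := sub_nonneg.mpr hsa.le_algebraMap_norm_self
    refine (CStarAlgebra.norm_le_norm_of_nonneg_of_le h0 (sub_le_self _ hx)).trans ?_
    rw [Algebra.algebraMap_eq_smul_one, norm_smul, norm_norm]
    exact mul_le_of_le_one_right (norm_nonneg _) (QPerm.norm_one_le A)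
  have hfx : f (algebraMap ℝ A ‖x‖ - x) = (‖x‖ : ℂ) - f x := by
    rw [map_sub, Algebra.algebraMap_eq_smul_one, ← Complex.coe_smul, map_smul, h1]
    simp
  have h2 : ‖(‖x‖ : ℂ) - f x‖ ≤ ‖x‖ :=
    hfx ▸ ((f.le_opNorm _).trans (mul_le_of_le_one_left (norm_nonneg _) hf)).trans hle
  have h3 := (Complex.re_le_norm _).trans h2
  simp only [Complex.sub_re, Complex.ofReal_re] at h3
  linarith

/-- Every `a ≠ 0` has a norming state. It is the Hahn–Banach extension of a character of the
commutative C*-algebra generated by `star a * a`. -/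
theorem exists_state_norming [PartialOrder A] [StarOrderedRing A] {a : A} (ha : a ≠ 0) :
    ∃ f : A →ₚ[ℂ] ℂ, f 1 = 1 ∧ f (star a * a) = (‖a‖ : ℂ) ^ 2 := by
  set h : A := star a * a with hh
  have hsa : IsSelfAdjoint h := IsSelfAdjoint.star_mul_self a
  have hnorm : ‖h‖ = ‖a‖ ^ 2 := by rw [hh, CStarRing.norm_star_mul_self, sq]
  have : IsStarNormal h := hsa.isStarNormal
  let C := StarAlgebra.elemental ℂ h
  let c : C := ⟨h, StarAlgebra.elemental.self_mem ℂ h⟩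
  have hc : c ≠ 0 := by
    intro h0
    have : h = 0 := congrArg Subtype.val h0
    exact ha ((CStarRing.star_mul_self_eq_zero_iff a).mp this)
  have : Nontrivial C := ⟨c, 0, hc⟩
  obtain ⟨z, hz, hzn⟩ := spectrum.exists_nnnorm_eq_spectralRadius c
  obtain ⟨χ, rfl⟩ := WeakDual.CharacterSpace.mem_spectrum_iff_exists.mp hz
  have hcsa : IsSelfAdjoint c := Subtype.ext hsa
  have hχ : ‖χ c‖ = ‖h‖ := by
    rw [hcsa.spectralRadius_eq_nnnorm] at hzn
    exact congrArg NNReal.toReal (ENNReal.coe_injective hzn)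
  obtain ⟨f, hfext, hfn⟩ :=
    exists_extension_norm_eq (𝕜 := ℂ) (E := A) (Subalgebra.toSubmodule C.toSubalgebra)
      (WeakDual.CharacterSpace.toCLM χ)
  have hf1 : f 1 = 1 := (hfext (1 : C)).trans (map_one χ)
  have hfle : ‖f‖ ≤ 1 := by
    rw [hfn]
    refine ContinuousLinearMap.opNorm_le_bound _ zero_le_one fun x => ?_
    rw [one_mul]
    exact NonUnitalStarAlgHom.norm_apply_le (χ : C →⋆ₐ[ℂ] ℂ) x
  have hpos : ∀ x, 0 ≤ x → 0 ≤ f x := fun x hx => apply_nonneg_of_norm_le_one f hf1 hfle hx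
  refine ⟨.mk₀ f.toLinearMap hpos, hf1, ?_⟩
  change f h = _
  have h0 : 0 ≤ f h := hpos h (star_mul_self_nonneg a)
  have h1 : ‖f h‖ = ‖a‖ ^ 2 := by
    rw [← hnorm, ← hχ]
    exact congrArg _ (hfext c)
  rw [Complex.nonneg_iff] at h0
  have h2 : f h = ((f h).re : ℂ) := Complex.ext rfl (by simpa using h0.2.symm)
  rw [h2, Complex.norm_real, Real.norm_eq_abs, abs_of_nonneg h0.1] at h1
  rw [h2, h1, Complex.ofReal_pow]

variable (A) in
/-- The norm of a C*-algebra is attained on a unit vector of some Hilbert space representation,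
the GNS representation of a norming state. -/
theorem exists_rep_norming (a : A) :
    ∃ (H : Type u) (_ : NormedAddCommGroup H) (_ : InnerProductSpace ℂ H) (_ : CompleteSpace H)
      (π : A →⋆ₐ[ℂ] (H →L[ℂ] H)) (ξ : H), ‖ξ‖ ≤ 1 ∧ ‖π a ξ‖ = ‖a‖ := by
  let := CStarAlgebra.spectralOrder A
  have := CStarAlgebra.spectralOrderedRing A
  rcases eq_or_ne a 0 with rfl | ha
  · obtain ⟨f⟩ : Nonempty (A →ₚ[ℂ] ℂ) := ⟨0⟩
    exact ⟨f.GNS, inferInstance, inferInstance, inferInstance, f.gnsStarAlgHom, 0, by simp, by simp⟩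
  · obtain ⟨f, hf1, hfa⟩ := exists_state_norming ha
    refine ⟨f.GNS, inferInstance, inferInstance, inferInstance, f.gnsStarAlgHom,
      ((f.toPreGNS 1 : f.PreGNS) : f.GNS), ?_, ?_⟩
    · rw [UniformSpace.Completion.norm_coe, f.preGNS_norm_def]
      simp [hf1]
    · change ‖f.gnsNonUnitalStarAlgHom a (f.toPreGNS 1 : f.PreGNS)‖ = _
      rw [f.gnsNonUnitalStarAlgHom_apply_coe, UniformSpace.Completion.norm_coe,
        f.preGNS_norm_def]
      simp only [PositiveLinearMap.leftMulMapPreGNS_apply, PositiveLinearMap.ofPreGNS_toPreGNS,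
        mul_one, hfa]
      rw [← Complex.ofReal_pow, Complex.ofReal_re, Real.sqrt_sq (norm_nonneg _)]

end States

/-! ### Slice maps of characters on the minimal tensor product -/

namespace MinTensor

variable {A B : Type u} [CStarAlgebra A] [CStarAlgebra B]

/-- A character of `B`, as a representation on a one-dimensional Hilbert space. -/
def charRep (χ : B →⋆ₐ[ℂ] ℂ) :
    B →⋆ₐ[ℂ] (EuclideanSpace ℂ PUnit.{u + 1} →L[ℂ] EuclideanSpace ℂ PUnit.{u + 1}) where
  __ := (Algebra.ofId ℂ _).comp χ.toAlgHom
  map_star' b := by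
    change algebraMap ℂ (EuclideanSpace ℂ PUnit.{u + 1} →L[ℂ] EuclideanSpace ℂ PUnit.{u + 1})
      (χ (star b)) = star (algebraMap ℂ _ (χ b))
    rw [map_star]
    exact algebraMap_star_comm (χ b)

/-- The slice map `χ ⊗ id` of a character `χ`, on the algebraic tensor product. -/
def sliceAlg (χ : B →⋆ₐ[ℂ] ℂ) : (B ⊗[ℂ] A) →⋆ₐ[ℂ] A where
  __ := (Algebra.TensorProduct.lid ℂ A).toAlgHom.comp
    (Algebra.TensorProduct.map χ.toAlgHom (AlgHom.id ℂ A))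
  map_star' x := by
    change (Algebra.TensorProduct.lid ℂ A).toAlgHom.comp
      (Algebra.TensorProduct.map χ.toAlgHom (AlgHom.id ℂ A)) (star x) =
      star ((Algebra.TensorProduct.lid ℂ A).toAlgHom.comp
        (Algebra.TensorProduct.map χ.toAlgHom (AlgHom.id ℂ A)) x)
    induction x using TensorProduct.induction_on with
    | zero => simp
    | add x y hx hy => rw [star_add, map_add, map_add, hx, hy, star_add]
    | tmul b a =>
      rw [TensorProduct.star_tmul]
      change χ (star b) • star a = star (χ b • a)
      rw [map_star, star_smul]

theorem sliceAlg_tmul (χ : B →⋆ₐ[ℂ] ℂ) (b : B) (a : A) : sliceAlg χ (b ⊗ₜ a) = χ b • a := rfl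

/-- On vectors `k ⊗ h` with `k` in the one-dimensional space of `χ`, the representation `χ ⊗ π` is
`π` after the slice map. -/
theorem tensorRep_charRep {H : Type u} [NormedAddCommGroup H] [InnerProductSpace ℂ H]
    [CompleteSpace H] (χ : B →⋆ₐ[ℂ] ℂ) (π : A →⋆ₐ[ℂ] (H →L[ℂ] H)) (x : B ⊗[ℂ] A)
    (k : EuclideanSpace ℂ PUnit.{u + 1}) (h : H) :
    tensorRep (charRep χ) π x (k ⊗ₜ h) = k ⊗ₜ π (sliceAlg χ x) h := by
  induction x using TensorProduct.induction_on with
  | zero => simp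
  | add x y hx hy =>
    rw [map_add, map_add, map_add, add_apply, add_apply,
      hx, hy, TensorProduct.tmul_add]
  | tmul b a =>
    rw [tensorRep_tmul, TensorProduct.mapL_tmul, sliceAlg_tmul, map_smul]
    change (χ b • k) ⊗ₜ[ℂ] π a h = k ⊗ₜ[ℂ] (χ b • π a h)
    rw [TensorProduct.smul_tmul]

/-- The slice map is contractive for the spatial norm, as `χ` and any representation of `A` are a
pair of representations that occurs in the supremum. -/
theorem norm_sliceAlg_le (χ : B →⋆ₐ[ℂ] ℂ) (x : B ⊗[ℂ] A) :
    ‖sliceAlg χ x‖ ≤ (spatialSeminorm B A).toFun x := by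
  obtain ⟨H, _, _, _, π, ξ, hξ, hπ⟩ := exists_rep_norming A (sliceAlg χ x)
  let k : EuclideanSpace ℂ PUnit.{u + 1} := EuclideanSpace.single PUnit.unit 1
  have hk : ‖k‖ = 1 := by simp [k]
  calc ‖sliceAlg χ x‖ = ‖tensorRep (charRep χ) π x (k ⊗ₜ ξ)‖ := by
        rw [tensorRep_charRep, TensorProduct.norm_tmul, hk, one_mul, hπ]
    _ ≤ ‖tensorRep (charRep χ) π x‖ * ‖k ⊗ₜ[ℂ] ξ‖ := ContinuousLinearMap.le_opNorm _ _
    _ ≤ ‖tensorRep (charRep χ) π x‖ := by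
        rw [TensorProduct.norm_tmul, hk, one_mul]
        exact mul_le_of_le_one_right (ContinuousLinearMap.opNorm_nonneg _) hξ
    _ ≤ spatialNorm x := norm_tensorRep_le _ _ x

/-- The slice map `χ ⊗ id : B ⊗ A → A` of a character `χ` of `B`. -/
def slice (χ : B →⋆ₐ[ℂ] ℂ) : MinTensor B A →⋆ₐ[ℂ] A :=
  (spatialSeminorm B A).lift (sliceAlg χ) (norm_sliceAlg_le χ)

theorem slice_tmul (χ : B →⋆ₐ[ℂ] ℂ) (b : B) (a : A) : slice χ (tmul b a) = χ b • a := by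
  rw [slice, tmul, CStarSeminorm.lift_ofHom, sliceAlg_tmul]

theorem continuous_slice (χ : B →⋆ₐ[ℂ] ℂ) : Continuous (slice χ : MinTensor B A → A) :=
  CStarSeminorm.continuous_lift _ _ _

variable {A' B' : Type u} [CStarAlgebra A'] [CStarAlgebra B']

theorem continuous_map (f : A →⋆ₐ[ℂ] A') (g : B →⋆ₐ[ℂ] B') : Continuous (map f g) :=
  CStarSeminorm.continuous_lift _ _ _

theorem tmul_add (a : A) (b b' : B) : tmul a (b + b') = tmul a b + tmul a b' := by
  simp only [tmul, TensorProduct.tmul_add, _root_.map_add]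

/-- A closed subset of `A ⊗ B` that contains `0` and the elementary tensors, and is closed under
addition, is everything. -/
theorem induction_on {P : MinTensor A B → Prop} (z : MinTensor A B) (hc : IsClosed {z | P z})
    (h0 : P 0) (ht : ∀ a b, P (tmul a b)) (ha : ∀ x y, P x → P y → P (x + y)) : P z := by
  refine (spatialSeminorm A B).denseRange_ofHom.induction_on z hc fun x => ?_
  induction x using TensorProduct.induction_on with
  | zero => rwa [map_zero]
  | tmul a b => exact ht a b
  | add x y hx hy => rw [map_add]; exact ha _ _ hx hy

/-- A character slices `B ⊗ Q` into `Q`, for a closed subalgebra `Q` of `A`. -/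
theorem slice_map_subtype_mem (χ : B →⋆ₐ[ℂ] ℂ) (Q : StarSubalgebra ℂ A) [hQ : IsClosed (Q : Set A)]
    (z : MinTensor B Q) : slice χ (map (StarAlgHom.id ℂ B) Q.subtype z) ∈ Q := by
  refine induction_on (P := fun z => slice χ (map (StarAlgHom.id ℂ B) Q.subtype z) ∈ Q) z
    ?_ ?_ ?_ ?_
  · exact hQ.preimage ((continuous_slice χ).comp (continuous_map _ _))
  · simp only [_root_.map_zero]; exact Q.zero_mem
  · intro b q
    rw [map_tmul, slice_tmul]
    exact Q.smul_mem q.2 _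
  · intro x y hx hy
    simp only [_root_.map_add]
    exact Q.add_mem hx hy

end MinTensor

/-! ### Spans of products of two subalgebras -/

section Span

variable {R X Y Z : Type*} [Ring R] [Algebra ℂ R] [Ring X] [Algebra ℂ X] [Ring Y] [Algebra ℂ Y]
  [Ring Z] [Algebra ℂ Z]

theorem mul_map_mem_span (α : X →ₐ[ℂ] R) (β : Y →ₐ[ℂ] R) {v : R}
    (hv : v ∈ Submodule.span ℂ {z | ∃ x y, z = α x * β y}) (y : Y) :
    v * β y ∈ Submodule.span ℂ {z | ∃ x y, z = α x * β y} := by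
  induction hv using Submodule.span_induction with
  | mem v hv =>
    obtain ⟨x, y', rfl⟩ := hv
    exact Submodule.subset_span ⟨x, y' * y, by rw [map_mul, mul_assoc]⟩
  | zero => rw [zero_mul]; exact Submodule.zero_mem _
  | add v w _ _ hv hw => rw [add_mul]; exact Submodule.add_mem _ hv hw
  | smul c v _ hv => rw [smul_mul_assoc]; exact Submodule.smul_mem _ c hv

theorem map_mul_mem_span (α : X →ₐ[ℂ] R) (β : Y →ₐ[ℂ] R) {v : R}
    (hv : v ∈ Submodule.span ℂ {z | ∃ x y, z = α x * β y}) (x : X) :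
    α x * v ∈ Submodule.span ℂ {z | ∃ x y, z = α x * β y} := by
  induction hv using Submodule.span_induction with
  | mem v hv =>
    obtain ⟨x', y, rfl⟩ := hv
    exact Submodule.subset_span ⟨x * x', y, by rw [map_mul, mul_assoc]⟩
  | zero => rw [mul_zero]; exact Submodule.zero_mem _
  | add v w _ _ hv hw => rw [mul_add]; exact Submodule.add_mem _ hv hw
  | smul c v _ hv => rw [mul_smul_comm]; exact Submodule.smul_mem _ c hv

/-- Although the span of `α(X) β(Y)` need not be a subalgebra, its preimage under a homomorphism
that commutes with `β` is one. -/
def spanPreimage (α : X →ₐ[ℂ] R) (β : Y →ₐ[ℂ] R) (γ : Z →ₐ[ℂ] R)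
    (hcomm : ∀ y z, β y * γ z = γ z * β y) : Subalgebra ℂ Z where
  carrier := {z | γ z ∈ Submodule.span ℂ {z | ∃ x y, z = α x * β y}}
  add_mem' {a b} ha hb := by
    rw [Set.mem_ofPred_eq, map_add]
    exact Submodule.add_mem _ ha hb
  algebraMap_mem' c := by
    refine Submodule.subset_span ⟨algebraMap ℂ X c, 1, ?_⟩
    rw [AlgHom.commutes, AlgHom.commutes, map_one, mul_one]
  mul_mem' {a b} ha hb := by
    rw [Set.mem_ofPred_eq, map_mul]
    rw [Set.mem_ofPred_eq] at ha
    generalize γ a = v at ha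
    induction ha using Submodule.span_induction with
    | mem v hv =>
      obtain ⟨x, y, rfl⟩ := hv
      rw [mul_assoc, hcomm]
      exact map_mul_mem_span α β (mul_map_mem_span α β hb y) x
    | zero => rw [zero_mul]; exact Submodule.zero_mem _
    | add v w _ _ hv hw => rw [add_mul]; exact Submodule.add_mem _ hv hw
    | smul c v _ hv => rw [smul_mul_assoc]; exact Submodule.smul_mem _ c hv

end Span

/-! ### The factors of the minimal tensor product, and its associativity -/

namespace MinTensor

variable {A B C : Type u} [CStarAlgebra A] [CStarAlgebra B] [CStarAlgebra C]

variable (A B) in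
/-- The embedding `a ↦ a ⊗ 1` of the left factor. -/
def inclLeft : A →ₐ[ℂ] MinTensor A B :=
  (spatialSeminorm A B).ofHom.toAlgHom.comp Algebra.TensorProduct.includeLeft

theorem inclLeft_apply (a : A) : inclLeft A B a = tmul a 1 := rfl

variable (A B) in
/-- The embedding `b ↦ 1 ⊗ b` of the right factor. -/
def inclRight : B →ₐ[ℂ] MinTensor A B :=
  (spatialSeminorm A B).ofHom.toAlgHom.comp Algebra.TensorProduct.includeRight

theorem inclRight_apply (b : B) : inclRight A B b = tmul 1 b := rfl

theorem norm_tmul_le (a : A) (b : B) : ‖tmul a b‖ ≤ ‖a‖ * ‖b‖ := by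
  rw [tmul, CStarSeminorm.norm_ofHom]
  refine spatialNorm_le (by positivity) ?_
  intro H K _ _ _ _ _ _ π ρ
  rw [tensorRep_tmul]
  refine (TensorProduct.norm_mapL_le _ _).trans ?_
  gcongr
  · exact norm_starAlgHom_le π a
  · exact norm_starAlgHom_le ρ b

theorem continuous_tmul_left (b : B) : Continuous fun a : A => tmul a b := by
  refine AddMonoidHomClass.continuous_of_bound (AddMonoidHom.mk' (fun a : A => tmul a b)
    fun a a' => add_tmul a a' b) ‖b‖ fun a => ?_
  rw [mul_comm]
  exact norm_tmul_le a b

theorem continuous_tmul_right (a : A) : Continuous fun b : B => tmul a b :=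
  AddMonoidHomClass.continuous_of_bound (AddMonoidHom.mk' (fun b : B => tmul a b)
    fun b b' => tmul_add a b b') ‖a‖ fun b => norm_tmul_le a b

theorem dense_of_tmul_mem (V : Submodule ℂ (MinTensor A B))
    (h : ∀ a b, tmul a b ∈ closure (V : Set (MinTensor A B))) :
    Dense (V : Set (MinTensor A B)) := by
  intro z
  refine induction_on (P := fun z => z ∈ V.topologicalClosure) z V.isClosed_topologicalClosure
    (Submodule.zero_mem _) h fun x y hx hy => Submodule.add_mem _ hx hy

variable (A B C) in
/-- The graph of the associativity isomorphism is a closed subalgebra of the product. -/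
def assocSubalgebra :
    Subalgebra ℂ (MinTensor (MinTensor A B) C × MinTensor A (MinTensor B C)) :=
  (Algebra.adjoin ℂ {z | ∃ (a : A) (b : B) (c : C),
    z = (tmul (tmul a b) c, tmul a (tmul b c))}).topologicalClosure

theorem coe_assocSubalgebra : (assocSubalgebra A B C :
    Set (MinTensor (MinTensor A B) C × MinTensor A (MinTensor B C))) = assocGraph A B C := by
  let T : Submonoid (MinTensor (MinTensor A B) C × MinTensor A (MinTensor B C)) :=
    { carrier := {z | ∃ (a : A) (b : B) (c : C), z = (tmul (tmul a b) c, tmul a (tmul b c))}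
      one_mem' := ⟨1, 1, 1, by simp only [← one_eq_tmul]; rfl⟩
      mul_mem' := by
        rintro _ _ ⟨a, b, c, rfl⟩ ⟨a', b', c', rfl⟩
        refine ⟨a * a', b * b', c * c', ?_⟩
        simp only [Prod.mk_mul_mk, tmul_mul_tmul] }
  have h := Algebra.adjoin_eq_span (R := ℂ)
    (T : Set (MinTensor (MinTensor A B) C × MinTensor A (MinTensor B C)))
  rw [Submonoid.closure_eq] at h
  exact congrArg (fun V : Submodule ℂ (MinTensor (MinTensor A B) C × MinTensor A (MinTensor B C)) =>
    closure (V : Set (MinTensor (MinTensor A B) C × MinTensor A (MinTensor B C)))) h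

theorem isClosed_assocSubalgebra : IsClosed (assocSubalgebra A B C :
    Set (MinTensor (MinTensor A B) C × MinTensor A (MinTensor B C))) :=
  isClosed_closure

theorem tmul_mem_assocSubalgebra (a : A) (b : B) (c : C) :
    (tmul (tmul a b) c, tmul a (tmul b c)) ∈ assocSubalgebra A B C :=
  subset_closure (Algebra.subset_adjoin ⟨a, b, c, rfl⟩)

end MinTensor

/-! ### The quantum permutation group -/

namespace QPerm

open MinTensor

variable {n : ℕ}

/-- The generators generate a dense subalgebra. As they are self-adjoint, the involution is not
needed. -/
theorem ofHom_mem_of_gen_mem (S : Subalgebra ℂ (QPerm.{u} n)) (h : ∀ i j, gen i j ∈ S)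
    (x : FreeStar (Idx.{u} n)) : (univSeminorm n).ofHom x ∈ S := by
  induction x using TensorProduct.induction_on with
  | zero => rw [map_zero]; exact S.zero_mem
  | add x y hx hy => rw [map_add]; exact S.add_mem hx hy
  | tmul z w =>
    have hz : z ⊗ₜ[ℝ] w = z • ((1 : ℂ) ⊗ₜ[ℝ] w) := by
      rw [TensorProduct.smul_tmul', smul_eq_mul, mul_one]
    rw [hz, map_smul]
    refine S.smul_mem ?_ z
    clear hz
    induction w using FreeAlgebra.induction with
    | grade0 r =>
      have hr : (1 : ℂ) ⊗ₜ[ℝ] algebraMap ℝ (FreeAlgebra ℝ (Idx.{u} n)) r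
          = algebraMap ℂ (FreeStar (Idx.{u} n)) r := by
        rw [Algebra.TensorProduct.algebraMap_apply, Algebra.algebraMap_eq_smul_one,
          TensorProduct.tmul_smul, TensorProduct.smul_tmul', Algebra.algebraMap_self,
          RingHom.id_apply, Complex.real_smul, mul_one]
      rw [hr, AlgHomClass.commutes]
      exact S.algebraMap_mem _
    | grade1 x => exact h x.down.1 x.down.2
    | mul a b ha hb =>
      have hab : (1 : ℂ) ⊗ₜ[ℝ] (a * b) = ((1 : ℂ) ⊗ₜ[ℝ] a) * ((1 : ℂ) ⊗ₜ[ℝ] b) := by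
        rw [Algebra.TensorProduct.tmul_mul_tmul, mul_one]
      rw [hab, map_mul]
      exact S.mul_mem ha hb
    | add a b ha hb =>
      rw [TensorProduct.tmul_add, map_add]
      exact S.add_mem ha hb

theorem mem_of_gen_mem (S : Subalgebra ℂ (QPerm.{u} n)) (hS : IsClosed (S : Set (QPerm.{u} n)))
    (h : ∀ i j, gen i j ∈ S) (a : QPerm.{u} n) : a ∈ S :=
  (univSeminorm n).denseRange_ofHom.induction_on a hS (ofHom_mem_of_gen_mem S h)

theorem continuous_comul : Continuous (comul.{u} n) :=
  CStarSeminorm.continuous_lift _ _ (norm_freeHom_le_univSeminorm isMagicUnitary_comul)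

theorem isCompactQuantumGroup_comul : IsCompactQuantumGroup (comul.{u} n) where
  coassoc a := by
    let F := ((MinTensor.map (comul.{u} n) (StarAlgHom.id ℂ (QPerm.{u} n))).comp (comul n)).toAlgHom
    let G := ((MinTensor.map (StarAlgHom.id ℂ (QPerm.{u} n)) (comul.{u} n)).comp (comul n)).toAlgHom
    have hF : Continuous F := (continuous_map _ _).comp continuous_comul
    have hG : Continuous G := (continuous_map _ _).comp continuous_comul
    rw [← coe_assocSubalgebra]
    refine mem_of_gen_mem ((assocSubalgebra _ _ _).comap (F.prod G))
      (isClosed_assocSubalgebra.preimage (hF.prodMk hG)) (fun i j => ?_) a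
    change (MinTensor.map (comul n) (StarAlgHom.id ℂ _) (comul n (gen i j)),
      MinTensor.map (StarAlgHom.id ℂ _) (comul n) (comul n (gen i j))) ∈ assocSubalgebra _ _ _
    have h : (MinTensor.map (comul n) (StarAlgHom.id ℂ _) (comul n (gen.{u} i j)),
        MinTensor.map (StarAlgHom.id ℂ _) (comul n) (comul n (gen.{u} i j)))
        = ∑ k, ∑ l, (tmul (tmul (gen.{u} i k) (gen k l)) (gen l j),
            tmul (gen i k) (tmul (gen k l) (gen l j))) := by
      simp only [comul_gen, map_sum, map_tmul, StarAlgHom.coe_id, id_eq, sum_tmul, tmul_sum,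
        ← prod_mk_sum]
      rw [Finset.sum_comm]
    rw [h]
    exact Subalgebra.sum_mem _ fun k _ => Subalgebra.sum_mem _ fun l _ =>
      tmul_mem_assocSubalgebra _ _ _
  -- `a_ij ⊗ 1 = ∑ k, Δ(a_ik) (1 ⊗ a_jk)`
  dense_right := by
    have hgen : ∀ i j, gen.{u} i j ∈ spanPreimage (comul.{u} n).toAlgHom (inclRight _ _)
        (inclLeft _ _) (fun y z => by
          simp only [inclRight_apply, inclLeft_apply, tmul_mul_tmul, one_mul, mul_one]) := by
      intro i j
      have h : tmul (gen.{u} i j) 1 = ∑ k, comul n (gen.{u} i k) * tmul 1 (gen j k) := by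
        simp only [comul_gen, Finset.sum_mul, tmul_mul_tmul, mul_one,
          isMagicUnitary_gen.mul_col _ _ j]
        rw [Finset.sum_comm, Finset.sum_eq_single j]
        · simp only [if_true, ← tmul_sum, isMagicUnitary_gen.sum_row]
        · intro l _ hl
          simp only [if_neg hl, tmul_zero, Finset.sum_const_zero]
        · simp
      change tmul (gen i j) 1 ∈ Submodule.span ℂ _
      rw [h]
      exact Submodule.sum_mem _ fun k _ => Submodule.subset_span ⟨_, _, rfl⟩
    refine dense_of_tmul_mem _ fun a b => ?_
    refine (univSeminorm n).denseRange_ofHom.induction_on a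
      (isClosed_closure.preimage (continuous_tmul_left b)) fun x => subset_closure ?_
    have h := mul_map_mem_span _ _ (ofHom_mem_of_gen_mem _ hgen x) b
    rwa [inclLeft_apply, inclRight_apply, tmul_mul_tmul, one_mul, mul_one] at h
  -- `1 ⊗ a_ij = ∑ k, Δ(a_kj) (a_ki ⊗ 1)`
  dense_left := by
    have hgen : ∀ i j, gen.{u} i j ∈ spanPreimage (comul.{u} n).toAlgHom (inclLeft _ _)
        (inclRight _ _) (fun y z => by
          simp only [inclRight_apply, inclLeft_apply, tmul_mul_tmul, one_mul, mul_one]) := by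
      intro i j
      have h : tmul 1 (gen.{u} i j) = ∑ k, comul n (gen.{u} k j) * tmul (gen k i) 1 := by
        simp only [comul_gen, Finset.sum_mul, tmul_mul_tmul, mul_one,
          isMagicUnitary_gen.mul_row _ _ i]
        rw [Finset.sum_comm, Finset.sum_eq_single i]
        · simp only [if_true, ← sum_tmul, isMagicUnitary_gen.sum_col]
        · intro l _ hl
          simp only [if_neg hl, zero_tmul, Finset.sum_const_zero]
        · simp
      change tmul 1 (gen i j) ∈ Submodule.span ℂ _
      rw [h]
      exact Submodule.sum_mem _ fun k _ => Submodule.subset_span ⟨_, _, rfl⟩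
    refine dense_of_tmul_mem _ fun a b => ?_
    refine (univSeminorm n).denseRange_ofHom.induction_on b
      (isClosed_closure.preimage (continuous_tmul_right a)) fun x => subset_closure ?_
    have h := mul_map_mem_span _ _ (ofHom_mem_of_gen_mem _ hgen x) a
    rwa [inclLeft_apply, inclRight_apply, tmul_mul_tmul, one_mul, mul_one] at h

open scoped ComplexOrder in
/-- The projections onto `ℂ (1, 0)` and `ℂ (1, 1)` do not commute. The index type of the matrices
is lifted to the universe of the C*-algebras in question. -/
theorem exists_projections_not_commute : ∃ (D : Type u) (_ : CStarAlgebra D) (p q : D),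
    star p = p ∧ p * p = p ∧ star q = q ∧ q * q = q ∧ p * q ≠ q * p := by
  let p : Matrix (ULift.{u} (Fin 2)) (ULift.{u} (Fin 2)) ℂ :=
    .of fun i j => !![(1 : ℂ), 0; 0, 0] i.down j.down
  let q : Matrix (ULift.{u} (Fin 2)) (ULift.{u} (Fin 2)) ℂ :=
    .of fun i j => !![(1 / 2 : ℂ), 1 / 2; 1 / 2, 1 / 2] i.down j.down
  have hsum : ∀ f : ULift.{u} (Fin 2) → ℂ, ∑ i, f i = f ⟨0⟩ + f ⟨1⟩ := fun f => by
    rw [← Equiv.sum_comp (Equiv.ulift.{u} (α := Fin 2)).symm f, Fin.sum_univ_two]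
    rfl
  let e := CStarMatrix.ofMatrixStarAlgEquiv (n := ULift.{u} (Fin 2)) (A := ℂ)
  have hp : star p = p := by
    ext ⟨i⟩ ⟨j⟩
    fin_cases i <;> fin_cases j <;> simp [p]
  have hpp : p * p = p := by
    ext ⟨i⟩ ⟨j⟩
    fin_cases i <;> fin_cases j <;> simp [Matrix.mul_apply, hsum, p]
  have hq : star q = q := by
    ext ⟨i⟩ ⟨j⟩
    fin_cases i <;> fin_cases j <;> simp [q]
  have hqq : q * q = q := by
    ext ⟨i⟩ ⟨j⟩
    fin_cases i <;> fin_cases j <;> simp [Matrix.mul_apply, hsum, q] <;> norm_num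
  refine ⟨CStarMatrix (ULift.{u} (Fin 2)) (ULift.{u} (Fin 2)) ℂ, inferInstance, e p, e q,
    by rw [← map_star, hp], by rw [← map_mul, hpp], by rw [← map_star, hq],
    by rw [← map_mul, hqq], fun h => ?_⟩
  have h' : p * q = q * p := e.injective ((map_mul e p q).trans (h.trans (map_mul e q p).symm))
  have h01 := congrFun (congrFun h' ⟨0⟩) ⟨1⟩
  simp [Matrix.mul_apply, hsum, p, q] at h01

/-- An involution `σ` and projections `d i` that are constant on its orbits give a magic unitary
with `2 × 2` blocks `(d i, 1 - d i; 1 - d i, d i)`, up to the order of the indices. -/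
theorem isMagicUnitary_of_involutive {D : Type*} [Ring D] [StarRing D] {σ : Fin n → Fin n}
    (hσ : Function.Involutive σ) {d : Fin n → D} (hd : ∀ i, d (σ i) = d i)
    (hs : ∀ i, star (d i) = d i) (hm : ∀ i, d i * d i = d i) :
    IsMagicUnitary fun i j => (if j = i then d i else 0) + (if j = σ i then 1 - d i else 0) where
  star_eq i j := by split_ifs <;> simp [hs]
  mul_self i j := by split_ifs <;> simp [hm, mul_sub, sub_mul]
  sum_col j := by
    have h : ∀ i, (if j = i then d i else 0) + (if j = σ i then 1 - d i else 0)
        = (if i = j then d j else 0) + (if i = σ j then 1 - d j else 0) := by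
      intro i
      have h1 : j = σ i ↔ i = σ j := ⟨fun h => by rw [h, hσ], fun h => by rw [h, hσ]⟩
      have h0 : j = i ↔ i = j := eq_comm
      simp only [h0, h1]
      congr 1
      · split_ifs with h
        · rw [h]
        · rfl
      · split_ifs with h
        · rw [h, hd]
        · rfl
    simp [h, Finset.sum_add_distrib]
  sum_row i := by simp [Finset.sum_add_distrib]

theorem exists_not_commute (hn : 4 ≤ n) : ∃ a b : QPerm.{u} n, a * b ≠ b * a := by
  obtain ⟨D, _, p, q, hp, hpp, hq, hqq, hpq⟩ := exists_projections_not_commute.{u}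
  let x : Fin 4 → Fin n := Fin.castLE hn
  -- the involution that exchanges the first two and the next two points
  let σ : Fin n → Fin n := fun i =>
    if i = x 0 then x 1 else if i = x 1 then x 0 else if i = x 2 then x 3 else
      if i = x 3 then x 2 else i
  have hx : Function.Injective x := Fin.castLE_injective hn
  have h01 : x 0 ≠ x 1 := hx.ne (by decide)
  have h02 : x 0 ≠ x 2 := hx.ne (by decide)
  have h03 : x 0 ≠ x 3 := hx.ne (by decide)
  have h12 : x 1 ≠ x 2 := hx.ne (by decide)
  have h13 : x 1 ≠ x 3 := hx.ne (by decide)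
  have h23 : x 2 ≠ x 3 := hx.ne (by decide)
  have hσ : Function.Involutive σ := by
    intro i
    simp only [σ]
    grind
  let d : Fin n → D := fun i => if i = x 0 ∨ i = x 1 then p else q
  have hd : ∀ i, d (σ i) = d i := by
    intro i
    simp only [σ, d]
    grind
  have hu := isMagicUnitary_of_involutive hσ hd
    (fun i => by simp only [d]; split_ifs <;> assumption)
    (fun i => by simp only [d]; split_ifs <;> assumption)
  have hp' : lift hu (gen (x 0) (x 0)) = p := by
    rw [lift_gen]
    simp [σ, d, h01]
  have hq' : lift hu (gen (x 2) (x 2)) = q := by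
    rw [lift_gen]
    simp [σ, d, h02.symm, h12.symm, h23]
  refine ⟨gen (x 0) (x 0), gen (x 2) (x 2), fun h => hpq ?_⟩
  rw [← hp', ← hq', ← map_mul, h, map_mul]

end QPerm

namespace Glued

/-! ### The topology of the quotient -/

section Topology

variable {n : ℕ} {Y : Type u} {Y₁ : Set Y}

/-- The class of `(x_i, y)`. -/
def mk (p : Fin n × Y) : Glued n Y₁ := Quotient.mk (glueSetoid n Y₁) p

theorem mk_eq_mk_iff {p q : Fin n × Y} : (mk p : Glued n Y₁) = mk q ↔
    (p.2 = q.2 ∧ p.2 ∈ Y₁) ∨ (p.2 = q.2 ∧ p.1 = q.1) :=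
  Quotient.eq (r := glueSetoid n Y₁)

theorem mk_eq_mk (i j : Fin n) {y : Y} (hy : y ∈ Y₁) : (mk (i, y) : Glued n Y₁) = mk (j, y) :=
  mk_eq_mk_iff.mpr (.inl ⟨rfl, hy⟩)

theorem mk_surjective : Function.Surjective (mk : Fin n × Y → Glued n Y₁) := Quotient.mk_surjective

variable [TopologicalSpace Y]

theorem continuous_mk : Continuous (mk : Fin n × Y → Glued n Y₁) := continuous_quotient_mk'

/-- The projection to `Y`. -/
def proj : C(Glued n Y₁, Y) where
  toFun := Quotient.lift Prod.snd (by rintro p q (⟨h, -⟩ | ⟨h, -⟩) <;> exact h)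
  continuous_toFun := continuous_quot_lift _ continuous_snd

/-- Outside of the closed set `Y₁`, the copies of `Y` remain open. -/
theorem isOpen_image_mk (h : IsClosed Y₁) (i : Fin n) :
    IsOpen (mk '' ({i} ×ˢ Y₁ᶜ) : Set (Glued n Y₁)) := by
  have : (mk : Fin n × Y → Glued n Y₁) ⁻¹' (mk '' ({i} ×ˢ Y₁ᶜ)) = {i} ×ˢ Y₁ᶜ := by
    refine Set.Subset.antisymm ?_ (Set.subset_preimage_image _ _)
    rintro ⟨k, y⟩ ⟨⟨j, z⟩, ⟨hj, hz⟩, hjk⟩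
    rcases mk_eq_mk_iff.mp hjk with ⟨-, h'⟩ | ⟨h1, h2⟩
    · exact absurd h' hz
    · exact ⟨h2 ▸ hj, h1 ▸ hz⟩
  refine isQuotientMap_quotient_mk'.isOpen_preimage.mp ?_
  change IsOpen ((mk : Fin n × Y → Glued n Y₁) ⁻¹' _)
  rw [this]
  exact (isOpen_discrete _).prod h.isOpen_compl

theorem t2Space [T2Space Y] (h : IsClosed Y₁) : T2Space (Glued n Y₁) where
  t2 := by
    intro x x' hx
    obtain ⟨⟨i, y⟩, rfl⟩ := mk_surjective x
    obtain ⟨⟨j, z⟩, rfl⟩ := mk_surjective x'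
    by_cases hyz : y = z
    · subst hyz
      have hy : y ∉ Y₁ := fun hy => hx (mk_eq_mk i j hy)
      have hij : i ≠ j := fun hij => hx (by rw [hij])
      refine ⟨_, _, isOpen_image_mk h i, isOpen_image_mk h j, ⟨(i, y), ⟨rfl, hy⟩, rfl⟩,
        ⟨(j, y), ⟨rfl, hy⟩, rfl⟩, Set.disjoint_left.mpr ?_⟩
      rintro _ ⟨⟨k, w⟩, ⟨rfl, hw⟩, rfl⟩ ⟨⟨l, v⟩, ⟨rfl, hv⟩, hkl⟩
      rcases mk_eq_mk_iff.mp hkl with ⟨-, h'⟩ | ⟨-, h'⟩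
      · exact hv h'
      · exact hij h'.symm
    · exact separated_by_continuous proj.continuous hyz

theorem connectedSpace [ConnectedSpace Y] (hn : 0 < n) (hY : Y₁.Nonempty) :
    ConnectedSpace (Glued n Y₁) := by
  obtain ⟨y₀, hy₀⟩ := hY
  have h : IsPreconnected (⋃ i : Fin n, Set.range fun y => (mk (i, y) : Glued n Y₁)) :=
    isPreconnected_iUnion
      ⟨mk (⟨0, hn⟩, y₀), Set.mem_iInter.mpr fun i => ⟨y₀, mk_eq_mk _ _ hy₀⟩⟩
      fun i => isPreconnected_range (continuous_mk.comp (by fun_prop))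
  have hu : (⋃ i : Fin n, Set.range fun y => (mk (i, y) : Glued n Y₁)) = Set.univ := by
    refine Set.eq_univ_of_forall fun x => ?_
    obtain ⟨⟨i, y⟩, rfl⟩ := mk_surjective x
    exact Set.mem_iUnion.mpr ⟨i, y, rfl⟩
  exact { isPreconnected_univ := hu ▸ h, toNonempty := ⟨mk (⟨0, hn⟩, y₀)⟩ }

end Topology

/-! ### The action on the quotient -/

section Functions

open MinTensor (tmul tmul_mul_tmul star_tmul one_eq_tmul tmul_sum sum_tmul add_tmul smul_tmul
  zero_tmul tmul_zero)

variable {n : ℕ} {Y : Type u} [TopologicalSpace Y] {Y₁ : Set Y}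

theorem gluedIncl_apply (F : C(Glued n Y₁, ℂ)) (p : Fin n × Y) :
    gluedIncl n Y₁ F p = F (mk p) := rfl

theorem ext_mk {F G : C(Glued n Y₁, ℂ)} (h : ∀ i y, F (mk (i, y)) = G (mk (i, y))) : F = G := by
  ext x
  obtain ⟨⟨i, y⟩, rfl⟩ := mk_surjective x
  exact h i y

/-- The function `e_k ⊗ G` on the quotient, for a function `G` on `Y` that vanishes on `Y₁`. -/
def sheet (k : Fin n) (G : C(Y, ℂ)) (hG : ∀ y ∈ Y₁, G y = 0) : C(Glued n Y₁, ℂ) where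
  toFun := Quotient.lift (_root_.sheet k G) (by
    rintro ⟨i, y⟩ ⟨j, z⟩ (⟨h, h'⟩ | ⟨h, h'⟩)
    · obtain rfl : y = z := h
      simp [_root_.sheet, hG y h']
    · obtain rfl : y = z := h
      obtain rfl : i = j := h'
      rfl)
  continuous_toFun := continuous_quot_lift _ (_root_.sheet k G).continuous

theorem sheet_mk (k : Fin n) (G : C(Y, ℂ)) (hG : ∀ y ∈ Y₁, G y = 0) (i : Fin n) (y : Y) :
    sheet k G hG (mk (i, y)) = if i = k then G y else 0 := rfl

/-- The restriction of `F` to the copy of `Y` with index `i`. -/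
def slice (i : Fin n) (F : C(Glued n Y₁, ℂ)) : C(Y, ℂ) := _root_.slice i (gluedIncl n Y₁ F)

theorem slice_apply (i : Fin n) (F : C(Glued n Y₁, ℂ)) (y : Y) : slice i F y = F (mk (i, y)) := rfl

theorem slice_sub_slice (i j : Fin n) (F : C(Glued n Y₁, ℂ)) :
    ∀ y ∈ Y₁, (slice i F - slice j F) y = 0 := fun y hy => by
  rw [ContinuousMap.sub_apply, slice_apply, slice_apply, mk_eq_mk i j hy, sub_self]

/-- The function on the quotient that has on every copy of `Y` the values of `F` on the copy with
index `j`. -/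
def const (j : Fin n) (F : C(Glued n Y₁, ℂ)) : C(Glued n Y₁, ℂ) := (slice j F).comp proj

theorem const_mk (j : Fin n) (F : C(Glued n Y₁, ℂ)) (i : Fin n) (y : Y) :
    const j F (mk (i, y)) = F (mk (j, y)) := rfl

/-- The function on the quotient that is `F (x_i, ·) - F (x_j, ·)` on the copy of `Y` with index
`k`, and `0` on the others. -/
def diff (j k i : Fin n) (F : C(Glued n Y₁, ℂ)) : C(Glued n Y₁, ℂ) :=
  sheet k (slice i F - slice j F) (slice_sub_slice i j F)

theorem diff_mk (j k i : Fin n) (F : C(Glued n Y₁, ℂ)) (l : Fin n) (y : Y) :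
    diff j k i F (mk (l, y)) = if l = k then F (mk (i, y)) - F (mk (j, y)) else 0 := rfl

theorem const_add_sum_diff (j : Fin n) (F : C(Glued n Y₁, ℂ)) :
    const j F + ∑ i, diff j i i F = F := by
  refine ext_mk fun l y => ?_
  simp [const_mk, diff_mk, ContinuousMap.sum_apply]

variable [CompactSpace Y]

variable (Y₁) in
/-- The restriction of `α` to the quotient. Fix an index `j`. A function `F` with restrictions
`F_i` to the copies of `Y` is the sum of the function `F_j` of `y` alone, on which `A_n` acts
trivially, and of the `e_i ⊗ (F_i - F_j)`, where `F_i - F_j` vanishes on `Y₁`. Thus `α F` is in the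
algebraic tensor product of `C((X_n × Y)/∼)` and `A_n`. -/
def action (j : Fin n) : C(Glued n Y₁, ℂ) →⋆ₐ[ℂ] MinTensor C(Glued n Y₁, ℂ) (QPerm.{u} n) where
  toFun F := tmul (const j F) 1 + ∑ i, ∑ k, tmul (diff j k i F) (QPerm.gen k i)
  map_one' := by
    have h1 : const j (1 : C(Glued n Y₁, ℂ)) = 1 := rfl
    have h2 : ∀ k i, diff j k i (1 : C(Glued n Y₁, ℂ)) = 0 := fun k i =>
      ext_mk fun l y => by simp [diff_mk]
    simp only [h1, h2, zero_tmul, Finset.sum_const_zero, add_zero, one_eq_tmul]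
  map_mul' F G := by
    have h1 : const j (F * G) = const j F * const j G := rfl
    have h2 : ∀ k i, diff j k i (F * G) = diff j k i F * const j G + const j F * diff j k i G
        + diff j k i F * diff j k i G := fun k i => ext_mk fun l y => by
      simp only [diff_mk, const_mk, ContinuousMap.mul_apply, ContinuousMap.add_apply]
      split_ifs <;> ring
    -- in the product of the double sums only the diagonal terms remain
    have h3 : ∀ k l i m, l ≠ k → diff j k i F * diff j l m G = 0 := fun k l i m hlk =>
      ext_mk fun r y => by
        simp only [diff_mk, ContinuousMap.mul_apply, ContinuousMap.zero_apply]
        split_ifs <;> simp_all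
    have h4 : (∑ i, ∑ k, tmul (diff j k i F) (QPerm.gen k i)) *
        (∑ i, ∑ k, tmul (diff j k i G) (QPerm.gen k i))
        = ∑ i, ∑ k, tmul (diff j k i F * diff j k i G) (QPerm.gen.{u} k i) := by
      rw [Finset.sum_mul]
      refine Finset.sum_congr rfl fun i _ => ?_
      rw [Finset.sum_mul]
      refine Finset.sum_congr rfl fun k _ => ?_
      rw [Finset.mul_sum, Finset.sum_eq_single i]
      · rw [Finset.mul_sum, Finset.sum_eq_single k]
        · rw [tmul_mul_tmul, QPerm.isMagicUnitary_gen.mul_self]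
        · intro l _ hl
          rw [tmul_mul_tmul, h3 _ _ _ _ hl, zero_tmul]
        · simp
      · intro m _ hm
        rw [Finset.mul_sum]
        refine Finset.sum_eq_zero fun l _ => ?_
        rw [tmul_mul_tmul]
        by_cases hlk : l = k
        · subst hlk
          rw [QPerm.isMagicUnitary_gen.mul_row, if_neg hm.symm, tmul_zero]
        · rw [h3 _ _ _ _ hlk, zero_tmul]
      · simp
    simp only [h1, h2, add_tmul, Finset.sum_add_distrib, add_mul, mul_add, h4]
    simp only [Finset.sum_mul, Finset.mul_sum, tmul_mul_tmul, one_mul, mul_one]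
    abel
  map_zero' := by
    have h1 : const j (0 : C(Glued n Y₁, ℂ)) = 0 := rfl
    have h2 : ∀ k i, diff j k i (0 : C(Glued n Y₁, ℂ)) = 0 := fun k i =>
      ext_mk fun l y => by simp [diff_mk]
    simp only [h1, h2, zero_tmul, Finset.sum_const_zero, add_zero]
  map_add' F G := by
    have h1 : const j (F + G) = const j F + const j G := rfl
    have h2 : ∀ k i, diff j k i (F + G) = diff j k i F + diff j k i G := fun k i =>
      ext_mk fun l y => by
        simp only [diff_mk, ContinuousMap.add_apply]
        split_ifs <;> ring
    simp only [h1, h2, add_tmul, Finset.sum_add_distrib]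
    abel
  commutes' c := by
    have h1 : const j (algebraMap ℂ C(Glued n Y₁, ℂ) c) = c • 1 :=
      ext_mk fun l y => by simp [const_mk]
    have h2 : ∀ k i, diff j k i (algebraMap ℂ C(Glued n Y₁, ℂ) c) = 0 := fun k i =>
      ext_mk fun l y => by simp [diff_mk]
    simp only [h1, h2, zero_tmul, Finset.sum_const_zero, add_zero]
    rw [Algebra.algebraMap_eq_smul_one, one_eq_tmul, smul_tmul]
  map_star' F := by
    have h1 : const j (star F) = star (const j F) := rfl
    have h2 : ∀ k i, diff j k i (star F) = star (diff j k i F) := fun k i =>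
      ext_mk fun l y => by
        simp only [diff_mk, ContinuousMap.star_apply]
        split_ifs <;> simp
    simp only [h1, h2, star_add, star_sum, star_tmul, QPerm.isMagicUnitary_gen.star_eq, star_one]

theorem action_apply (j : Fin n) (F : C(Glued n Y₁, ℂ)) : action Y₁ j F
    = tmul (const j F) 1 + ∑ i, ∑ k, tmul (diff j k i F) (QPerm.gen.{u} k i) := rfl

/-- The restricted action is compatible with `α`, since the rows of `(a_ij)` sum up to `1`. -/
theorem map_action (j : Fin n) (F : C(Glued n Y₁, ℂ)) :
    MinTensor.map (gluedIncl n Y₁) (StarAlgHom.id ℂ (QPerm.{u} n)) (action Y₁ j F)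
      = prodAction n Y (gluedIncl n Y₁ F) := by
  have h1 : gluedIncl n Y₁ (const j F)
      = ∑ k, _root_.sheet k (_root_.slice j (gluedIncl n Y₁ F)) := by
    ext p
    simp [ContinuousMap.sum_apply, _root_.sheet, gluedIncl_apply, _root_.slice]
    rfl
  have h2 : ∀ k i, _root_.sheet k (_root_.slice i (gluedIncl n Y₁ F))
      = _root_.sheet k (_root_.slice j (gluedIncl n Y₁ F)) + gluedIncl n Y₁ (diff j k i F) := by
    intro k i
    ext p
    rw [ContinuousMap.add_apply, gluedIncl_apply, diff_mk]
    simp only [_root_.sheet, _root_.slice, gluedIncl_apply, ContinuousMap.coe_mk,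
      ContinuousMap.comp_apply]
    split_ifs <;> ring
  have h3 : prodAction n Y (gluedIncl n Y₁ F)
      = ∑ i, ∑ k, (tmul (_root_.sheet k (_root_.slice j (gluedIncl n Y₁ F))) (QPerm.gen.{u} k i)
          + tmul (gluedIncl n Y₁ (diff j k i F)) (QPerm.gen k i)) := by
    change ∑ i, ∑ k, tmul (_root_.sheet k (_root_.slice i (gluedIncl n Y₁ F)))
      (QPerm.gen.{u} k i) = _
    exact Finset.sum_congr rfl fun i _ => Finset.sum_congr rfl fun k _ => by rw [h2 k i, add_tmul]
  simp only [h3, Finset.sum_add_distrib, action_apply, map_add, map_sum,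
    MinTensor.map_tmul, StarAlgHom.coe_id, id_eq, h1]
  congr 1
  rw [Finset.sum_comm]
  simp only [← tmul_sum, QPerm.isMagicUnitary_gen.sum_row, sum_tmul]

theorem action_const (j : Fin n) (F : C(Glued n Y₁, ℂ)) :
    action Y₁ j (const j F) = tmul (const j F) 1 := by
  have h1 : const j (const j F) = const j F := rfl
  have h2 : ∀ k i, diff j k i (const j F) = 0 := fun k i =>
    ext_mk fun l y => by simp [diff_mk, const_mk]
  simp only [action_apply, h1, h2, zero_tmul, Finset.sum_const_zero, add_zero]

/-- The restricted action does not depend on the index `j` on functions `e_k ⊗ G`. For `k = j`, the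
subtracted terms `e_l ⊗ G ⊗ a_li` sum up to `e_l ⊗ G ⊗ 1` for each `l`, and they cancel the constant
term. -/
theorem action_sheet (j k : Fin n) (G : C(Y, ℂ)) (hG : ∀ y ∈ Y₁, G y = 0) :
    action Y₁ j (sheet k G hG) = ∑ l, tmul (sheet l G hG) (QPerm.gen.{u} l k) := by
  obtain ⟨c, hc⟩ : ∃ c : ℂ, c = if j = k then 1 else 0 := ⟨_, rfl⟩
  have h1 : const j (sheet k G hG) = c • ∑ l, sheet l G hG := ext_mk fun l y => by
    simp only [const_mk, sheet_mk, ContinuousMap.smul_apply, ContinuousMap.sum_apply, hc]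
    simp
  have h2 : ∀ l i, diff j l i (sheet k G hG)
      = ((if i = k then (1 : ℂ) else 0) - c) • sheet l G hG :=
    fun l i => ext_mk fun m y => by
      simp only [diff_mk, sheet_mk, ContinuousMap.smul_apply, smul_eq_mul, hc]
      split_ifs <;> simp
  have h3 : ∀ l, ∑ i, ((if i = k then (1 : ℂ) else 0) - c) •
      tmul (sheet l G hG) (QPerm.gen.{u} l i)
      = tmul (sheet l G hG) (QPerm.gen l k) - c • tmul (sheet l G hG) 1 := fun l => by
    simp only [sub_smul, Finset.sum_sub_distrib, ite_smul, one_smul, zero_smul,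
      Finset.sum_ite_eq', Finset.mem_univ, if_true, ← Finset.smul_sum, ← tmul_sum,
      QPerm.isMagicUnitary_gen.sum_row]
  rw [action_apply, Finset.sum_comm]
  simp only [h1, h2, smul_tmul, sum_tmul, h3, Finset.sum_sub_distrib, Finset.smul_sum]
  abel

theorem isQuantumAction_action (j : Fin n) :
    IsQuantumAction (QPerm.comul.{u} n) (action Y₁ j) where
  coaction F := by
    rw [← MinTensor.coe_assocSubalgebra]
    have h : (MinTensor.map (action Y₁ j) (StarAlgHom.id ℂ _) (action Y₁ j F),
        MinTensor.map (StarAlgHom.id ℂ _) (QPerm.comul.{u} n) (action Y₁ j F))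
        = (tmul (tmul (const j F) 1) 1, tmul (const j F) (tmul 1 1)) +
          ∑ i, ∑ k, ∑ l, (tmul (tmul (diff j l i F) (QPerm.gen.{u} l k)) (QPerm.gen k i),
            tmul (diff j l i F) (tmul (QPerm.gen l k) (QPerm.gen k i))) := by
      rw [action_apply]
      simp only [map_add, map_sum, MinTensor.map_tmul, StarAlgHom.coe_id, id_eq, action_const,
        map_one, one_eq_tmul, QPerm.comul_gen, tmul_sum, ← prod_mk_sum]
      rw [Prod.mk_add_mk]
      congr 2
      · refine Finset.sum_congr rfl fun i _ => Finset.sum_congr rfl fun k _ => ?_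
        rw [diff, action_sheet, sum_tmul]
        rfl
      · exact Finset.sum_congr rfl fun i _ => Finset.sum_comm
    rw [h]
    exact add_mem (MinTensor.tmul_mem_assocSubalgebra _ _ _) (sum_mem fun i _ => sum_mem fun k _ =>
      sum_mem fun l _ => MinTensor.tmul_mem_assocSubalgebra _ _ _)
  dense := by
    set V : Submodule ℂ (MinTensor C(Glued n Y₁, ℂ) (QPerm.{u} n)) :=
      Submodule.span ℂ {z | ∃ F a, z = action Y₁ j F * tmul 1 a}
    have hV : ∀ F a, action Y₁ j F * tmul 1 a ∈ V := fun F a => Submodule.subset_span ⟨F, a, rfl⟩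
    have hconst : ∀ F a, tmul (const j F) a ∈ V := fun F a => by
      have := hV (const j F) a
      rwa [action_const, tmul_mul_tmul, one_mul, mul_one] at this
    have hdiff : ∀ i F a, tmul (diff j i i F) a ∈ V := fun i F a => by
      -- every summand is `diff j i i F ⊗ a_ik a`
      have h : tmul (diff j i i F) a
          = ∑ k, action Y₁ j (diff j k i F) * tmul 1 (QPerm.gen i k * a) := by
        have hk : ∀ k, action Y₁ j (diff j k i F) * tmul 1 (QPerm.gen i k * a)
            = tmul (diff j i i F) (QPerm.gen i k * a) := by
          intro k
          rw [diff, action_sheet, Finset.sum_mul, Finset.sum_eq_single i]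
          · rw [tmul_mul_tmul, ← mul_assoc, QPerm.isMagicUnitary_gen.mul_self, mul_one]
            rfl
          · intro l _ hl
            rw [tmul_mul_tmul, ← mul_assoc, QPerm.isMagicUnitary_gen.mul_col, if_neg hl, zero_mul,
              tmul_zero]
          · simp
        simp only [hk, ← tmul_sum, ← Finset.sum_mul, QPerm.isMagicUnitary_gen.sum_row, one_mul]
      rw [h]
      exact sum_mem fun k _ => hV _ _
    refine MinTensor.dense_of_tmul_mem V fun F a => subset_closure ?_
    rw [← const_add_sum_diff j F, add_tmul, sum_tmul]
    exact add_mem (hconst F a) (sum_mem fun i _ => hdiff i F a)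

/-- If `G` vanishes on `Y₁` and `G y = 1`, then slicing `α (e_i ⊗ G)` at the point `(x_k, y)` gives
the generator `a_ki`. Hence any closed subalgebra through which the action factors contains all
generators. -/
theorem isFaithfulAction_action [T2Space Y] (hclosed : IsClosed Y₁) (hproper : Y₁ ≠ Set.univ)
    (j : Fin n) : IsFaithfulAction (QPerm.comul.{u} n) (action Y₁ j) := by
  intro Q hQ ΔQ αQ _ _ hα _
  obtain ⟨y, hy⟩ := (Set.ne_univ_iff_exists_notMem _).mp hproper
  obtain ⟨g, hg0, hg1, -⟩ := exists_continuous_zero_one_of_isClosed hclosed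
    (isClosed_singleton (x := y)) (Set.disjoint_singleton_right.mpr hy)
  let G : C(Y, ℂ) := ⟨fun z => (g z : ℂ), by fun_prop⟩
  have hG : ∀ z ∈ Y₁, G z = 0 := fun z hz => by simp [G, hg0 hz]
  have hGy : G y = 1 := by simp [G, hg1 (Set.mem_singleton y)]
  have hgen : ∀ k i, QPerm.gen.{u} k i ∈ Q := by
    intro k i
    let χ : C(Glued n Y₁, ℂ) →⋆ₐ[ℂ] ℂ := ContinuousMap.evalStarAlgHom ℂ ℂ (mk (k, y))
    have h := MinTensor.slice_map_subtype_mem χ Q (αQ (sheet i G hG))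
    have hχ : ∀ l, χ (sheet l G hG) = if k = l then G y else 0 := fun l => sheet_mk l G hG k y
    rw [hα, action_sheet, map_sum] at h
    simp only [MinTensor.slice_tmul, hχ, hGy, ite_smul, one_smul, zero_smul, Finset.sum_ite_eq,
      Finset.mem_univ, if_true] at h
    exact h
  exact eq_top_iff.mpr fun a _ => QPerm.mem_of_gen_mem Q.toSubalgebra hQ hgen a

end Functions

end Glued

end

theorem mainTheorem1 {Y : Type u} [TopologicalSpace Y] [CompactSpace Y] [T2Space Y]
    (Y₁ : Set Y) (hclosed : IsClosed Y₁) (hproper : Y₁ ≠ Set.univ) (n : ℕ) (hn : 0 < n) :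
    -- `(A_n, Δ_n)` is a compact quantum group, and the quotient space is compact and Hausdorff
    IsCompactQuantumGroup (QPerm.comul.{u} n) ∧
    CompactSpace (Glued n Y₁) ∧ T2Space (Glued n Y₁) ∧
    -- `α` restricts to an action of `A_n` on the quotient space, and this action is faithful
    (∃ αt : C(Glued n Y₁, ℂ) →⋆ₐ[ℂ] MinTensor C(Glued n Y₁, ℂ) (QPerm.{u} n),
      (∀ F : C(Glued n Y₁, ℂ),
        MinTensor.map (gluedIncl n Y₁) (StarAlgHom.id ℂ (QPerm.{u} n)) (αt F)
          = prodAction n Y (gluedIncl n Y₁ F)) ∧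
      IsQuantumAction (QPerm.comul.{u} n) αt ∧
      IsFaithfulAction (QPerm.comul.{u} n) αt) ∧
    -- the quotient space is connected if `Y` is connected and `Y₁` is non-empty
    (ConnectedSpace Y → Y₁.Nonempty → ConnectedSpace (Glued n Y₁)) ∧
    -- the quantum group is genuine for `n ≥ 4`
    (4 ≤ n → ∃ a b : QPerm.{u} n, a * b ≠ b * a) := by
  let j : Fin n := ⟨0, hn⟩
  refine ⟨QPerm.isCompactQuantumGroup_comul, inferInstance, Glued.t2Space hclosed,
    ⟨Glued.action Y₁ j, Glued.map_action j, Glued.isQuantumAction_action j,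
      Glued.isFaithfulAction_action hclosed hproper j⟩, ?_, QPerm.exists_not_commute⟩
  intro _ hY
  exact Glued.connectedSpace hn hY
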